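/- Let $d_1,d_2\in\mathbb N_0$ and let $\mathrm E(d)=\mathrm O(d)\ltimes\mathbb R^d$ be the Euclidean group with elements $(A,b)$, topologized as a subspace of $\mathbb R^{d\times d}\times\mathbb R^d$. A $d$-dimensional space group is a discrete subgroup of $\mathrm E(d)$ which contains $d$ linearly independent translations. For $A_1\in\mathrm O(d_1)$ and $(A_2,b_2)\in\mathrm E(d_2)$ put $A_1\oplus(A_2,b_2)=\left(\begin{pmatrix}A_1&0\\0&A_2\end{pmatrix},\begin{pmatrix}0\\b_2\end{pmatrix}\right)\in\mathrm E(d_1+d_2)$, and let $\pi\colon \mathrm O(d_1)\oplus\mathrm E(d_2)\to\mathrm E(d_2)$, $A\oplus g\mapsto g$. Let $\mathcal S$ be a $d_2$-dimensional space group with subgroup of translations $\mathcal T_{\mathcal S}$, let $\mathcal G\le\mathrm O(d_1)\oplus\mathcal S$ be discrete with $\pi(\mathcal G)=\mathcal S$, and let $\mathcal T\subset\mathcal G$ be a subset which $\pi$ maps bijectively onto $\mathcal T_{\mathcal S}$. For $N\in\mathbb N=\{1,2,\dots\}$ let $\mathcal T^N=\{t^N : t\in\mathcal T\}$, and let $M$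 be the set of all $N\in\mathbb N$ such that $\mathcal T^N$ is a normal subgroup of $\mathcal G$. For $N\in M$ let $\mathcal C_N$ be a representation set of $\mathcal G/\mathcal T^N$. A function $u$ on $\mathcal G$ is $\mathcal T^N$-periodic if $u(g)=u(gt)$ for all $g\in\mathcal G$, $t\in\mathcal T^N$, and periodic if it is $\mathcal T^N$-periodic for some $N\in M$. Let $L^\infty_{\mathrm{per}}(\mathcal G,\mathbb C^{m\times n})$ be the set of all periodic functions $\mathcal G\to\mathbb C^{m\times n}$, with $$\langle u,v\rangle=\frac1{|\mathcal C_N|}\sum_{g\in\mathcal C_N}\langle u(g),v(g)\rangle$$ whenever $u,v$ are $\mathcal T^N$-periodic, $N\in M$, where $\langle A,B\rangle=\sum_{i,j}a_{ij}\overline{b_{ij}}$ for matrices. A representation of $\mathcal G$ is a homomorphism $\rho\colon\mathcal G\to\mathrm U(d_\rho)$, $d_\rho\in\mathbb N$; two representations are equivalent if they are conjugate by a unitary matrix. Let $\mathcal E$ be a set containing exactly one representative of each equivalence class of periodic irreducible representations of $\mathcal G$. For $u\in L^\infty_{\mathrm{per}}(\mathcal G,\mathbb C^{m\times n})$ and a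 periodic representation $\rho$ of $\mathcal G$ let $$\widehat u(\rho)=\frac1{|\mathcal C_N|}\sum_{g\in\mathcal C_N}u(g)\otimes\rho(g)\in\mathbb C^{(md_\rho)\times(nd_\rho)},$$ where $N\in M$ is such that $u$ and $\rho$ are $\mathcal T^N$-periodic and $\otimes$ is the Kronecker product. Then the sets $\mathcal C_N$ are finite, suitable $N$ exist, and $\langle u,v\rangle$ and $\widehat u(\rho)$ do not depend on the choice of $N$ and $\mathcal C_N$. The Fourier transformation $$L^\infty_{\mathrm{per}}(\mathcal G,\mathbb C^{m\times n})\to\bigoplus_{\rho\in\mathcal E}\mathbb C^{(md_\rho)\times(nd_\rho)},\qquad u\mapsto(\widehat u(\rho))_{\rho\in\mathcal E}$$ is well-defined (in particular, only finitely many $\widehat u(\rho)$ are nonzero) and bijective. Moreover, $$\langle u,v\rangle=\sum_{\rho\in\mathcal E}d_\rho\langle\widehat u(\rho),\widehat v(\rho)\rangle\qquad\text{for all }u,v\in L^\infty_{\mathrm{per}}(\mathcal G,\mathbb C^{m\times n}).$$ -/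

import Mathlib

open scoped Matrix Kronecker DirectSum ComplexConjugate

noncomputable section

namespace DiscreteIsometry

/-! ### The Euclidean group -/

/-- The Euclidean group `E(d) = O(d) ⋉ ℝ^d`, where the coordinates of `ℝ^d` are indexed by the
finite type `ι` (so `d` is the cardinality of `ι`). -/
@[ext]
structure Euc (ι : Type) [Fintype ι] [DecidableEq ι] where
  rot : Matrix.orthogonalGroup ι ℝ
  trans : ι → ℝ

namespace Euc

variable {ι : Type} [Fintype ι] [DecidableEq ι]

instance : Mul (Euc ι) :=
  ⟨fun g h => ⟨g.rot * h.rot, g.trans + (g.rot : Matrix ι ι ℝ) *ᵥ h.trans⟩⟩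

instance : One (Euc ι) := ⟨⟨1, 0⟩⟩

instance : Inv (Euc ι) :=
  ⟨fun g => ⟨g.rot⁻¹, -(((g.rot⁻¹ : Matrix.orthogonalGroup ι ℝ) : Matrix ι ι ℝ) *ᵥ g.trans)⟩⟩

theorem mul_def (g h : Euc ι) :
    g * h = ⟨g.rot * h.rot, g.trans + (g.rot : Matrix ι ι ℝ) *ᵥ h.trans⟩ := rfl

theorem one_def : (1 : Euc ι) = ⟨1, 0⟩ := rfl

theorem inv_def (g : Euc ι) :
    g⁻¹ = ⟨g.rot⁻¹, -(((g.rot⁻¹ : Matrix.orthogonalGroup ι ℝ) : Matrix ι ι ℝ) *ᵥ g.trans)⟩ := rfl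

instance : Group (Euc ι) :=
  Group.ofLeftAxioms
    (by
      intro a b c
      simp only [mul_def, Matrix.UnitaryGroup.mul_val, Matrix.mulVec_add, Matrix.mulVec_mulVec,
        mul_assoc, add_assoc])
    (by
      intro a
      simp [mul_def, one_def])
    (by
      intro a
      simp [mul_def, one_def, inv_def])

/-- The topology of `E(d)` as a subspace of `ℝ^{d×d} × ℝ^d`. -/
instance : TopologicalSpace (Euc ι) :=
  TopologicalSpace.induced
    (fun g => ((g.rot : Matrix ι ι ℝ), g.trans)) inferInstance

/-- The group of all translations of `ℝ^d`. -/
def translations (ι : Type) [Fintype ι] [DecidableEq ι] : Subgroup (Euc ι) where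
  carrier := {g | g.rot = 1}
  one_mem' := rfl
  mul_mem' := by
    intro a b ha hb
    simp only [Set.mem_ofPred_eq] at ha hb
    simp [mul_def, ha, hb]
  inv_mem' := by
    intro a ha
    simp only [Set.mem_ofPred_eq] at ha
    simp [inv_def, ha]

end Euc

/-- A `d`-dimensional space group: a discrete subgroup of `E(d)` which contains `d` linearly
independent translations. -/
def IsSpaceGroup {ι : Type} [Fintype ι] [DecidableEq ι] (S : Subgroup (Euc ι)) : Prop :=
  DiscreteTopology S ∧
    ∃ t : ι → Euc ι, (∀ i, t i ∈ S ⊓ Euc.translations ι) ∧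
      LinearIndependent ℝ (fun i => (t i).trans)

/-! ### The embedding `O(d₁) × E(d₂) → E(d₁ + d₂)` -/

section DirectSum

variable {ι κ : Type} [Fintype ι] [DecidableEq ι] [Fintype κ] [DecidableEq κ]

/-- The block diagonal orthogonal matrix `A ⊕ B`. -/
def blockDiag (A : Matrix.orthogonalGroup ι ℝ) (B : Matrix.orthogonalGroup κ ℝ) :
    Matrix.orthogonalGroup (ι ⊕ κ) ℝ :=
  ⟨Matrix.fromBlocks (A : Matrix ι ι ℝ) 0 0 (B : Matrix κ κ ℝ), by
    have hA := (Matrix.mem_orthogonalGroup_iff _ _).1 A.2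
    have hB := (Matrix.mem_orthogonalGroup_iff _ _).1 B.2
    rw [Matrix.mem_orthogonalGroup_iff, Matrix.fromBlocks_transpose, Matrix.fromBlocks_multiply]
    simp [hA, hB]⟩

/-- The homomorphism `O(d₁) × E(d₂) → E(d₁ + d₂)`,
`(A₁, (A₂, b₂)) ↦ A₁ ⊕ (A₂, b₂) := (A₁ ⊕ A₂, (0, b₂))`. -/
def directSum (ι κ : Type) [Fintype ι] [DecidableEq ι] [Fintype κ] [DecidableEq κ] :
    Matrix.orthogonalGroup ι ℝ × Euc κ →* Euc (ι ⊕ κ) where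
  toFun p := ⟨blockDiag p.1 p.2.rot, Sum.elim 0 p.2.trans⟩
  map_one' := by
    ext i j
    · simp [blockDiag, Euc.one_def]
    · cases i <;> simp [Euc.one_def]
  map_mul' := by
    intro p q
    ext i j
    · simp [blockDiag, Euc.mul_def, Matrix.fromBlocks_multiply]
    · cases i <;> simp [blockDiag, Euc.mul_def, Matrix.fromBlocks_mulVec]

theorem directSum_injective : Function.Injective (directSum ι κ) := by
  rintro ⟨A, B, b⟩ ⟨A', B', b'⟩ h
  have h1 := congrArg (fun g : Euc (ι ⊕ κ) => (g.rot : Matrix (ι ⊕ κ) (ι ⊕ κ) ℝ)) h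
  have h2 := congrArg Euc.trans h
  simp only [directSum, blockDiag, MonoidHom.coe_mk, OneHom.coe_mk] at h1 h2
  obtain ⟨hA, -, -, hB⟩ := Matrix.fromBlocks_inj.1 h1
  have hb : b = b' := by
    funext i
    simpa using congrFun h2 (Sum.inr i)
  rw [Subtype.ext hA, Subtype.ext hB, hb]

/-- The natural surjective homomorphism `O(d₁) ⊕ E(d₂) → E(d₂)`, `A ⊕ g ↦ g`. -/
def natProj (ι κ : Type) [Fintype ι] [DecidableEq ι] [Fintype κ] [DecidableEq κ] :
    (directSum ι κ).range →* Euc κ :=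
  (MonoidHom.snd _ _).comp (MonoidHom.ofInjective directSum_injective).symm.toMonoidHom

end DirectSum

/-- A space group `SG` in dimension `d₂` together with a discrete group `G ≤ O(d₁) ⊕ SG`
such that `π(G) = SG`, where `π` is the natural homomorphism `O(d₁) ⊕ E(d₂) → E(d₂)`. -/
structure Setting (d₁ d₂ : ℕ) where
  SG : Subgroup (Euc (Fin d₂))
  isSpaceGroup : IsSpaceGroup SG
  G : Subgroup (Euc (Fin d₁ ⊕ Fin d₂))
  discrete : DiscreteTopology G
  le_range : G ≤ (directSum (Fin d₁) (Fin d₂)).range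
  map_natProj : (G.subgroupOf (directSum (Fin d₁) (Fin d₂)).range).map
    (natProj (Fin d₁) (Fin d₂)) = SG

namespace Setting

variable {d₁ d₂ : ℕ}

/-- The homomorphism `π` restricted to `G`. -/
def π (S : Setting d₁ d₂) : S.G →* Euc (Fin d₂) :=
  (natProj (Fin d₁) (Fin d₂)).comp (Subgroup.inclusion S.le_range)

/-- The subgroup of translations of the space group. -/
def TSG (S : Setting d₁ d₂) : Subgroup (Euc (Fin d₂)) := S.SG ⊓ Euc.translations (Fin d₂)

/-- `T ⊆ G` is a translational section: `π` restricts to a bijection from `T` onto the group of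
translations of the space group. -/
def IsSection (S : Setting d₁ d₂) (T : Set S.G) : Prop :=
  Set.BijOn S.π T (S.TSG : Set (Euc (Fin d₂)))

end Setting

/-! ### Periodic functions -/

section Periodic

variable {Γ : Type} [Group Γ]

/-- The set of powers `T^N = {t^N | t ∈ T}`. -/
def powSet (T : Set Γ) (N : ℕ) : Set Γ := (fun t => t ^ N) '' T

/-- The set of all positive integers `N` such that `T^N` is a normal subgroup. -/
def goodExponents (T : Set Γ) : Set ℕ :=
  {N | 0 < N ∧ ∃ H : Subgroup Γ, H.Normal ∧ (H : Set Γ) = powSet T N}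

/-- `u` is `T^N`-periodic. -/
def IsPeriodicWith {X : Type*} (T : Set Γ) (N : ℕ) (u : Γ → X) : Prop :=
  ∀ g, ∀ t ∈ powSet T N, u g = u (g * t)

/-- `u` is periodic. -/
def IsPeriodic {X : Type*} (T : Set Γ) (u : Γ → X) : Prop :=
  ∃ N ∈ goodExponents T, IsPeriodicWith T N u

/-- The set `L^∞_per(Γ, ℂ^{m×n})` of all periodic matrix-valued functions. -/
def LPer (T : Set Γ) (m n : ℕ) : Set (Γ → Matrix (Fin m) (Fin n) ℂ) := {u | IsPeriodic T u}

/-- `C` is a representation set of `Γ / T^N`: every coset `g T^N` contains exactly one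
element of `C`. -/
def IsCosetRepSet (T : Set Γ) (N : ℕ) (C : Set Γ) : Prop :=
  ∀ g : Γ, ∃! c, c ∈ C ∧ ∃ t ∈ powSet T N, c = g * t

/-- The average `(1/|C|) ∑_{g ∈ C} f(g)` over a finite set `C`. -/
def average {V : Type*} [AddCommGroup V] [Module ℂ V] (C : Set Γ) (f : Γ → V) : V :=
  ((C.ncard : ℂ)⁻¹) • ∑ᶠ g ∈ C, f g

/-- The Frobenius inner product `∑ᵢⱼ aᵢⱼ conj(bᵢⱼ)`. -/
def frobenius {α β : Type} [Fintype α] [Fintype β] (A B : Matrix α β ℂ) : ℂ :=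
  ∑ i, ∑ j, A i j * conj (B i j)

open Classical in
/-- The inner product `⟨u, v⟩ = (1/|C_N|) ∑_{g ∈ C_N} ⟨u(g), v(g)⟩`, where `N` is an admissible
exponent such that `u` and `v` are `T^N`-periodic. Here `C` is the chosen family
of representation sets. -/
def perInner (T : Set Γ) (C : ℕ → Set Γ) {m n : ℕ} (u v : Γ → Matrix (Fin m) (Fin n) ℂ) : ℂ :=
  if h : ∃ N ∈ goodExponents T, IsPeriodicWith T N u ∧ IsPeriodicWith T N v then
    average (C h.choose) (fun g => frobenius (u g) (v g))
  else 0

/-! ### Representations and the Fourier transform -/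

/-- A (finite-dimensional, unitary) representation `Γ → U(d)` of positive dimension `d`. -/
structure URep (Γ : Type) [Group Γ] where
  dim : ℕ
  dim_pos : 0 < dim
  hom : Γ →* Matrix.unitaryGroup (Fin dim) ℂ

/-- The matrix `ρ(g)`. -/
def URep.mat (ρ : URep Γ) (g : Γ) : Matrix (Fin ρ.dim) (Fin ρ.dim) ℂ := ρ.hom g

/-- The only invariant subspaces are `0` and the whole space. -/
def URep.IsIrreducible (ρ : URep Γ) : Prop :=
  ∀ W : Submodule ℂ (Fin ρ.dim → ℂ), (∀ g, ∀ w ∈ W, ρ.mat g *ᵥ w ∈ W) → W = ⊥ ∨ W = ⊤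

/-- Unitary equivalence: the dimensions agree and `Tᴴ ρ(g) T = ρ'(g)` for a unitary `T`. -/
def URep.Equivalent (ρ ρ' : URep Γ) : Prop :=
  ρ.dim = ρ'.dim ∧ ∃ U : Matrix (Fin ρ.dim) (Fin ρ'.dim) ℂ,
    Uᴴ * U = 1 ∧ U * Uᴴ = 1 ∧ ∀ g, Uᴴ * ρ.mat g * U = ρ'.mat g

/-- `E` is a representation set of the set of equivalence classes of periodic irreducible
representations. -/
def IsPeriodicDualRepSet (T : Set Γ) (E : Set (URep Γ)) : Prop :=
  (∀ ρ ∈ E, ρ.IsIrreducible ∧ IsPeriodic T ρ.mat) ∧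
    ∀ σ : URep Γ, σ.IsIrreducible → IsPeriodic T σ.mat → ∃! ρ, ρ ∈ E ∧ ρ.Equivalent σ

open Classical in
/-- The Fourier transform `û(ρ) = (1/|C_N|) ∑_{g ∈ C_N} u(g) ⊗ ρ(g)`, where `N` is an admissible
exponent such that `u` and `ρ` are `T^N`-periodic and `⊗` is the Kronecker product. -/
def perFourier (T : Set Γ) (C : ℕ → Set Γ) {m n : ℕ} (u : Γ → Matrix (Fin m) (Fin n) ℂ)
    (ρ : URep Γ) : Matrix (Fin m × Fin ρ.dim) (Fin n × Fin ρ.dim) ℂ :=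
  if h : ∃ N ∈ goodExponents T, IsPeriodicWith T N u ∧ IsPeriodicWith T N ρ.mat then
    average (C h.choose) (fun g => u g ⊗ₖ ρ.mat g)
  else 0

end Periodic

end DiscreteIsometry

end

open DiscreteIsometry

/-! For an admissible exponent `N` the normal subgroup `T^N` has finite index, so `T^N`-periodic
functions are functions on a finite group and the theorem there is classical harmonic analysis:
Schur orthogonality together with completeness of matrix coefficients. What remains is to show that
admissible exponents exist and to fit the levels `N` together.

Existence (`goodExponents_nonempty`): discreteness makes `ker π` finite, and a suitable power map,
its exponent built from `|ker π|` and `|Aut (ker π)|`, is a homomorphism on the preimage of the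
translations and trivial on `ker π`; its image is `T^N`. Finite index
(`Setting.IsSection.finiteIndex`): the translations in `T^N` move each element so that its
translation part is bounded, and only finitely many elements of a discrete group have this property.

At one level, averaging over cosets gives orthogonality (`URep.cosetMean_mul_conj_self`,
`URep.cosetMean_mul_conj_eq_zero`). Completeness (`eq_zero_of_cosetMean_mul_mat_eq_zero`) follows by
finding an irreducible piece inside the space of functions with vanishing coefficients: its elements
are combinations of conjugate matrix coefficients, hence orthogonal to themselves. Inversion and
Plancherel follow entrywise.

Levels are compatible for three reasons. Products of admissible exponents are admissible and give
smaller subgroups (`mul_mem_goodExponents`); averages do not change on passing to a smaller subgroup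
(`cosetMean_of_le`); and a function invariant under `H = T^N` has zero transform at every
irreducible representation nontrivial on `H` (`cosetMean_mul_mat_eq_zero`). Thus each transform is
supported on the finite set `trivialOn E H`, and every finitely supported family lives at some
level. -/

noncomputable section

namespace DiscreteIsometry

/-! ### Averages over the cosets of a finite-index subgroup. -/

section CosetMean

variable {Γ : Type} [Group Γ]

/-- `f` is invariant under right translation by elements of `H`. -/
def RightInvariant {X : Type*} (H : Subgroup Γ) (f : Γ → X) : Prop :=
  ∀ g, ∀ h ∈ H, f (g * h) = f g

theorem RightInvariant.mono {X : Type*} {H K : Subgroup Γ} {f : Γ → X}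
    (hf : RightInvariant H f) (hK : K ≤ H) : RightInvariant K f :=
  fun g h hh => hf g h (hK hh)

theorem RightInvariant.comp {X Y : Type*} {H : Subgroup Γ} {f : Γ → X}
    (hf : RightInvariant H f) (φ : X → Y) : RightInvariant H (fun g => φ (f g)) :=
  fun g h hh => congrArg φ (hf g h hh)

theorem RightInvariant.comp₂ {X Y Z : Type*} {H : Subgroup Γ} {f : Γ → X} {f' : Γ → Y}
    (hf : RightInvariant H f) (hf' : RightInvariant H f') (φ : X → Y → Z) :
    RightInvariant H (fun g => φ (f g) (f' g)) :=
  fun g h hh => by simp only [hf g h hh, hf' g h hh]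

theorem RightInvariant.eq_of_mk_eq {X : Type*} {H : Subgroup Γ} {f : Γ → X}
    (hf : RightInvariant H f) {a b : Γ} (h : (a : Γ ⧸ H) = b) : f a = f b := by
  have := hf a _ (QuotientGroup.eq.1 h)
  rw [← this, mul_inv_cancel_left]

theorem RightInvariant.out_mk {X : Type*} {H : Subgroup Γ} {f : Γ → X}
    (hf : RightInvariant H f) (g : Γ) : f ((g : Γ ⧸ H).out) = f g :=
  hf.eq_of_mk_eq (QuotientGroup.out_eq' _)

theorem RightInvariant.left_mul_mem {X : Type*} {H : Subgroup Γ} [hH : H.Normal] {f : Γ → X}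
    (hf : RightInvariant H f) {h : Γ} (hh : h ∈ H) (g : Γ) : f (h * g) = f g := by
  have := hf g (g⁻¹ * h * g) (by
    simpa using hH.conj_mem h hh g⁻¹)
  rw [← this]
  congr 1
  group

variable {V W : Type*} [AddCommGroup V] [Module ℂ V] [AddCommGroup W] [Module ℂ W]

/-- The mean value of a right `H`-invariant function over the cosets of `H`. -/
def cosetMean (H : Subgroup Γ) (f : Γ → V) : V :=
  ((Nat.card (Γ ⧸ H) : ℂ)⁻¹) • ∑ᶠ q : Γ ⧸ H, f q.out

theorem cosetMean_eq_sum (H : Subgroup Γ) [Fintype (Γ ⧸ H)] (f : Γ → V) :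
    cosetMean H f = ((Nat.card (Γ ⧸ H) : ℂ)⁻¹) • ∑ q : Γ ⧸ H, f q.out := by
  rw [cosetMean, finsum_eq_sum_of_fintype]

/-- Left multiplication by `x` permutes the left cosets of `H`. -/
theorem cosetMean_left_mul (H : Subgroup Γ) {f : Γ → V} (hf : RightInvariant H f) (x : Γ) :
    cosetMean H (fun g => f (x * g)) = cosetMean H f := by
  unfold cosetMean
  congr 1
  rw [← finsum_comp_equiv (MulAction.toPerm x : Equiv.Perm (Γ ⧸ H)) (f := fun q => f q.out)]
  refine finsum_congr fun q => hf.eq_of_mk_eq ?_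
  rw [QuotientGroup.out_eq', MulAction.toPerm_apply]
  conv_rhs => rw [← QuotientGroup.out_eq' q]
  rfl

theorem cosetMean_const (H : Subgroup Γ) [H.FiniteIndex] (v : V) :
    cosetMean H (fun _ => v) = v := by
  have := H.fintypeQuotientOfFiniteIndex
  rw [cosetMean_eq_sum, Finset.sum_const, Finset.card_univ, ← Nat.card_eq_fintype_card,
    ← Nat.cast_smul_eq_nsmul ℂ, smul_smul, inv_mul_cancel₀, one_smul]
  exact Nat.cast_ne_zero.2 Nat.card_pos.ne'

theorem map_cosetMean (H : Subgroup Γ) [H.FiniteIndex] (φ : V →ₗ[ℂ] W) (f : Γ → V) :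
    φ (cosetMean H f) = cosetMean H (fun g => φ (f g)) := by
  have := H.fintypeQuotientOfFiniteIndex
  simp only [cosetMean_eq_sum, map_smul, map_sum]

theorem cosetMean_sum (H : Subgroup Γ) [H.FiniteIndex] {ι : Type*} (s : Finset ι)
    (f : ι → Γ → V) :
    cosetMean H (fun g => ∑ i ∈ s, f i g) = ∑ i ∈ s, cosetMean H (f i) := by
  have := H.fintypeQuotientOfFiniteIndex
  simp only [cosetMean_eq_sum, ← Finset.smul_sum]
  rw [Finset.sum_comm]

theorem cosetMean_mul_left (H : Subgroup Γ) [H.FiniteIndex] (c : ℂ) (f : Γ → ℂ) :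
    cosetMean H (fun g => c * f g) = c * cosetMean H f :=
  (map_cosetMean H (LinearMap.mulLeft ℂ c) f).symm

theorem conj_cosetMean (H : Subgroup Γ) [H.FiniteIndex] (f : Γ → ℂ) :
    conj (cosetMean H f) = cosetMean H (fun g => conj (f g)) := by
  have := H.fintypeQuotientOfFiniteIndex
  simp [cosetMean_eq_sum]

theorem cosetMean_apply (H : Subgroup Γ) [H.FiniteIndex] {α β : Type*}
    (f : Γ → Matrix α β ℂ) (i : α) (j : β) :
    cosetMean H f i j = cosetMean H (fun g => f g i j) :=
  map_cosetMean H (Matrix.entryLinearMap ℂ ℂ i j) f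

theorem eq_zero_of_cosetMean_mul_conj (H : Subgroup Γ) [H.FiniteIndex] {f : Γ → ℂ}
    (hf : RightInvariant H f) (h : cosetMean H (fun g => f g * conj (f g)) = 0) : f = 0 := by
  have := H.fintypeQuotientOfFiniteIndex
  have hc : (Nat.card (Γ ⧸ H) : ℂ) ≠ 0 := Nat.cast_ne_zero.2 Nat.card_pos.ne'
  rw [cosetMean_eq_sum, smul_eq_zero, or_iff_right (inv_ne_zero hc)] at h
  simp only [Complex.mul_conj] at h
  rw [← Complex.ofReal_sum, Complex.ofReal_eq_zero,
    Finset.sum_eq_zero_iff_of_nonneg fun _ _ => Complex.normSq_nonneg _] at h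
  funext g
  rw [← hf.out_mk g]
  exact Complex.normSq_eq_zero.1 (h g (Finset.mem_univ _))

/-- Each coset of `H` splits into `[H : K]` cosets of `K`, and `f` is constant on it. This is what
makes the averages independent of the exponent. -/
theorem cosetMean_of_le {H K : Subgroup Γ} [K.FiniteIndex] (hK : K ≤ H) {f : Γ → V}
    (hf : RightInvariant H f) : cosetMean K f = cosetMean H f := by
  have : H.FiniteIndex := Subgroup.finiteIndex_of_le hK
  have := H.fintypeQuotientOfFiniteIndex
  have := K.fintypeQuotientOfFiniteIndex
  have hfin : Finite (H ⧸ K.subgroupOf H) := inferInstance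
  have := Fintype.ofFinite (H ⧸ K.subgroupOf H)
  have he : ∀ p, f ((Subgroup.quotientEquivProdOfLE hK).symm p).out = f p.1.out := by
    rintro ⟨a, b⟩
    obtain ⟨b, rfl⟩ := QuotientGroup.mk_surjective b
    have : (Subgroup.quotientEquivProdOfLE hK).symm (a, (b : H ⧸ K.subgroupOf H)) =
      ((a.out * b : Γ) : Γ ⧸ K) := rfl
    rw [this, (hf.mono hK).out_mk, hf _ _ b.2]
  rw [cosetMean_eq_sum, cosetMean_eq_sum,
    ← Equiv.sum_comp (Subgroup.quotientEquivProdOfLE hK).symm, Fintype.sum_prod_type]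
  simp only [he, Finset.sum_const, Finset.card_univ]
  rw [← Finset.smul_sum, Nat.card_congr (Subgroup.quotientEquivProdOfLE hK), Nat.card_prod,
    ← Nat.cast_smul_eq_nsmul ℂ, smul_smul, Nat.card_eq_fintype_card (α := H ⧸ _)]
  have hc : (Fintype.card (H ⧸ K.subgroupOf H) : ℂ) ≠ 0 := Nat.cast_ne_zero.2 Fintype.card_ne_zero
  congr 1
  push_cast
  rw [mul_inv, mul_assoc, inv_mul_cancel₀ hc, mul_one]

theorem bijective_mk_of_isCosetRepSet {T : Set Γ} {N : ℕ} {H : Subgroup Γ}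
    (hH : (H : Set Γ) = powSet T N) {D : Set Γ} (hD : IsCosetRepSet T N D) :
    Function.Bijective (fun g : D => ((g : Γ) : Γ ⧸ H)) := by
  constructor
  · intro a b hab
    refine Subtype.ext ((hD a).unique ⟨a.2, 1, ?_, by simp⟩ ⟨b.2, (a : Γ)⁻¹ * b, ?_, by simp⟩)
    · rw [← hH]; exact H.one_mem
    · rw [← hH]; exact QuotientGroup.eq.1 hab
  · intro q
    obtain ⟨c, ⟨hc, t, ht, hct⟩, -⟩ := hD q.out
    refine ⟨⟨c, hc⟩, ?_⟩
    rw [← QuotientGroup.out_eq' q]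
    rw [← hH] at ht
    exact (QuotientGroup.eq.2 (by simpa [hct] using ht)).symm

theorem finite_of_isCosetRepSet {T : Set Γ} {N : ℕ} {H : Subgroup Γ} [H.FiniteIndex]
    (hH : (H : Set Γ) = powSet T N) {D : Set Γ} (hD : IsCosetRepSet T N D) : D.Finite :=
  Set.finite_coe_iff.1 (Finite.of_injective _ (bijective_mk_of_isCosetRepSet hH hD).1)

theorem nonempty_of_isCosetRepSet {T : Set Γ} {N : ℕ} {D : Set Γ} (hD : IsCosetRepSet T N D) :
    D.Nonempty :=
  let ⟨c, hc, _⟩ := hD 1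
  ⟨c, hc.1⟩

/-- Translates averages over arbitrary representation sets into `cosetMean`, so that the choice of
representatives disappears. -/
theorem average_eq_cosetMean {T : Set Γ} {N : ℕ} {H : Subgroup Γ}
    (hH : (H : Set Γ) = powSet T N) {D : Set Γ} (hD : IsCosetRepSet T N D) {f : Γ → V}
    (hf : RightInvariant H f) : average D f = cosetMean H f := by
  have hb := bijective_mk_of_isCosetRepSet hH hD
  unfold average cosetMean
  rw [← Nat.card_coe_set_eq, Nat.card_congr (Equiv.ofBijective _ hb),
    ← finsum_set_coe_eq_finsum_mem]
  congr 1
  exact finsum_eq_of_bijective _ hb fun g => (hf.out_mk _).symm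

end CosetMean

/-! ### Schur's lemma and the orthogonality relations. -/

section Schur

variable {Γ : Type} [Group Γ]

namespace URep

theorem mat_mul (ρ : URep Γ) (g h : Γ) : ρ.mat (g * h) = ρ.mat g * ρ.mat h := by
  simp [mat]

theorem mat_one (ρ : URep Γ) : ρ.mat 1 = 1 := by
  simp [mat]

theorem mat_inv (ρ : URep Γ) (g : Γ) : ρ.mat g⁻¹ = (ρ.mat g)ᴴ := by
  simp [mat, Matrix.star_eq_conjTranspose]

theorem conjTranspose_mul_mat (ρ : URep Γ) (g : Γ) : (ρ.mat g)ᴴ * ρ.mat g = 1 := by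
  rw [← mat_inv, ← mat_mul, inv_mul_cancel, mat_one]

theorem dim_ne_zero (ρ : URep Γ) : (ρ.dim : ℂ) ≠ 0 :=
  Nat.cast_ne_zero.2 ρ.dim_pos.ne'

instance (ρ : URep Γ) : NeZero ρ.dim := ⟨ρ.dim_pos.ne'⟩

/-- Schur's lemma: the commutant of an irreducible representation consists of scalars. -/
theorem IsIrreducible.exists_eq_smul_one {ρ : URep Γ} (hρ : ρ.IsIrreducible)
    {X : Matrix (Fin ρ.dim) (Fin ρ.dim) ℂ} (hX : ∀ g, ρ.mat g * X = X * ρ.mat g) :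
    ∃ c : ℂ, X = c • 1 := by
  obtain ⟨c, hc⟩ := Module.End.exists_eigenvalue (Matrix.toLin' X)
  refine ⟨c, ?_⟩
  have hmem : ∀ w, w ∈ Module.End.eigenspace (Matrix.toLin' X) c ↔ X *ᵥ w = c • w := fun w => by
    rw [Module.End.mem_eigenspace_iff, Matrix.toLin'_apply]
  -- Eigenspaces of an operator commuting with `ρ` are invariant, so a nonzero one is everything.
  have htop := (hρ (Module.End.eigenspace (Matrix.toLin' X) c) fun g w hw => by
    rw [hmem] at hw ⊢
    rw [Matrix.mulVec_mulVec, ← hX, ← Matrix.mulVec_mulVec, hw,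
      Matrix.mulVec_smul]).resolve_left hc
  refine Matrix.ext_of_mulVec_single fun i => ?_
  rw [(hmem _).1 (htop ▸ Submodule.mem_top), Matrix.smul_mulVec, Matrix.one_mulVec]

/-- By Schur's lemma `Xᴴ * X` and `X * Xᴴ` are scalars; they are the same positive scalar `c`, so `X
/ √c` is a unitary intertwiner. -/
theorem equivalent_of_intertwiner {ρ σ : URep Γ} (hρ : ρ.IsIrreducible) (hσ : σ.IsIrreducible)
    {X : Matrix (Fin ρ.dim) (Fin σ.dim) ℂ} (hX : ∀ g, ρ.mat g * X = X * σ.mat g) (h0 : X ≠ 0) :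
    ρ.Equivalent σ := by
  have hX' : ∀ g, Xᴴ * ρ.mat g = σ.mat g * Xᴴ := fun g => by
    have := congrArg Matrix.conjTranspose (hX g⁻¹)
    simpa [Matrix.conjTranspose_mul, mat_inv] using this
  obtain ⟨c, hc⟩ := hσ.exists_eq_smul_one (X := Xᴴ * X) fun g => by
    rw [← Matrix.mul_assoc, ← hX', Matrix.mul_assoc, hX, Matrix.mul_assoc]
  obtain ⟨c', hc'⟩ := hρ.exists_eq_smul_one (X := X * Xᴴ) fun g => by
    rw [← Matrix.mul_assoc, hX, Matrix.mul_assoc, ← hX', Matrix.mul_assoc]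
  have hcc : c = c' := by
    have h1 : X * (Xᴴ * X) = (X * Xᴴ) * X := (Matrix.mul_assoc _ _ _).symm
    rw [hc, hc', Matrix.mul_smul, Matrix.smul_mul, Matrix.mul_one, Matrix.one_mul] at h1
    exact smul_left_injective ℂ h0 h1
  subst hcc
  have hc0 : c ≠ 0 := by
    rintro rfl
    rw [zero_smul] at hc
    open scoped ComplexOrder in
    exact h0 (Matrix.conjTranspose_mul_self_eq_zero.1 hc)
  -- Compare the traces of `Xᴴ * X` and `X * Xᴴ`.
  have hdim : ρ.dim = σ.dim := by
    have h1 := Matrix.trace_mul_comm Xᴴ X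
    rw [hc, hc', Matrix.trace_smul, Matrix.trace_smul, Matrix.trace_one, Matrix.trace_one,
      smul_eq_mul, smul_eq_mul, Fintype.card_fin, Fintype.card_fin] at h1
    exact_mod_cast (mul_left_cancel₀ hc0 h1).symm
  -- The diagonal entry of `Xᴴ * X` at `0` is the squared norm of a column of `X`.
  obtain ⟨r, hr, rfl⟩ : ∃ r : ℝ, 0 < r ∧ c = (r : ℂ) := by
    have h1 := congrFun (congrFun hc 0) 0
    simp only [Matrix.mul_apply, Matrix.conjTranspose_apply, Matrix.smul_apply,
      Matrix.one_apply_eq, smul_eq_mul, mul_one] at h1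
    have h2 : c = ((∑ i, Complex.normSq (X i 0) : ℝ) : ℂ) := by
      rw [← h1]
      push_cast
      refine Finset.sum_congr rfl fun i _ => ?_
      rw [Complex.normSq_eq_conj_mul_self]
      rfl
    refine ⟨_, lt_of_le_of_ne (Finset.sum_nonneg fun i _ => Complex.normSq_nonneg _) ?_, h2⟩
    intro h3
    rw [← h3] at h2
    exact hc0 (by simpa using h2)
  have hs : ((Real.sqrt r : ℂ)⁻¹ * (Real.sqrt r : ℂ)⁻¹) * (r : ℂ) = 1 := by
    have : (Real.sqrt r : ℂ) * Real.sqrt r = r := by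
      rw [← Complex.ofReal_mul, Real.mul_self_sqrt hr.le]
    rw [← mul_inv, this, inv_mul_cancel₀ hc0]
  have hU : ((Real.sqrt r : ℂ)⁻¹ • X)ᴴ = (Real.sqrt r : ℂ)⁻¹ • Xᴴ := by
    rw [Matrix.conjTranspose_smul]
    simp
  have hUU : ((Real.sqrt r : ℂ)⁻¹ • X)ᴴ * ((Real.sqrt r : ℂ)⁻¹ • X) = 1 := by
    rw [hU, Matrix.smul_mul, Matrix.mul_smul, hc, smul_smul, smul_smul, hs, one_smul]
  refine ⟨hdim, (Real.sqrt r : ℂ)⁻¹ • X, hUU, ?_, fun g => ?_⟩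
  · rw [hU, Matrix.smul_mul, Matrix.mul_smul, hc', smul_smul, smul_smul, hs, one_smul]
  · rw [Matrix.mul_assoc, Matrix.mul_smul, hX, ← Matrix.smul_mul, ← Matrix.mul_assoc, hUU,
      Matrix.one_mul]

variable {H : Subgroup Γ} [H.FiniteIndex]

/-- The mean value of `ρ(g) A σ(g)ᴴ`, which intertwines `σ` and `ρ`. -/
def intertwiningMean (H : Subgroup Γ) (ρ σ : URep Γ) (A : Matrix (Fin ρ.dim) (Fin σ.dim) ℂ) :
    Matrix (Fin ρ.dim) (Fin σ.dim) ℂ :=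
  cosetMean H fun g => ρ.mat g * A * (σ.mat g)ᴴ

/-- Substituting `x * g` for `g` leaves the mean unchanged but conjugates it by `ρ x` and `σ x`. -/
theorem mat_mul_intertwiningMean {ρ σ : URep Γ} (hρ : RightInvariant H ρ.mat)
    (hσ : RightInvariant H σ.mat) (A : Matrix (Fin ρ.dim) (Fin σ.dim) ℂ) (x : Γ) :
    ρ.mat x * intertwiningMean H ρ σ A = intertwiningMean H ρ σ A * σ.mat x := by
  have h1 : intertwiningMean H ρ σ A =
      ρ.mat x * intertwiningMean H ρ σ A * (σ.mat x)ᴴ := by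
    have h2 := cosetMean_left_mul H (f := fun g => ρ.mat g * A * (σ.mat g)ᴴ)
      (hρ.comp₂ hσ fun a b => a * A * bᴴ) x
    have h3 := map_cosetMean H ((mulRightLinearMap (Fin ρ.dim) ℂ (σ.mat x)ᴴ) ∘ₗ
      (mulLeftLinearMap (Fin σ.dim) ℂ (ρ.mat x))) (fun g => ρ.mat g * A * (σ.mat g)ᴴ)
    simp only [LinearMap.comp_apply, mulRightLinearMap_apply, mulLeftLinearMap_apply] at h3
    rw [intertwiningMean, h3, ← h2]
    congr 1
    funext g
    simp only [mat_mul, Matrix.conjTranspose_mul, Matrix.mul_assoc]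
  conv_rhs => rw [h1]
  rw [Matrix.mul_assoc, conjTranspose_mul_mat, Matrix.mul_one]

/-- Feeding in a matrix unit turns Schur's lemma for the mean into a statement about products of
matrix coefficients. -/
theorem intertwiningMean_single_apply (ρ σ : URep Γ) (i j : Fin ρ.dim) (k l : Fin σ.dim) :
    intertwiningMean H ρ σ (Matrix.single j l 1) i k =
      cosetMean H fun g => ρ.mat g i j * conj (σ.mat g k l) := by
  rw [intertwiningMean, cosetMean_apply]
  congr 1
  funext g
  simp [Matrix.mul_apply, Matrix.single_apply, Finset.sum_ite_eq, ite_and]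

/-- Matrix coefficients of inequivalent irreducible representations are orthogonal. -/
theorem cosetMean_mul_conj_eq_zero {ρ σ : URep Γ} (hρ : RightInvariant H ρ.mat)
    (hσ : RightInvariant H σ.mat) (hρ' : ρ.IsIrreducible) (hσ' : σ.IsIrreducible)
    (hne : ¬ ρ.Equivalent σ) (i j : Fin ρ.dim) (k l : Fin σ.dim) :
    cosetMean H (fun g => ρ.mat g i j * conj (σ.mat g k l)) = 0 := by
  rw [← intertwiningMean_single_apply]
  by_contra h
  refine hne (equivalent_of_intertwiner hρ' hσ'
    (mat_mul_intertwiningMean hρ hσ (Matrix.single j l 1)) fun h0 => h ?_)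
  rw [h0, Matrix.zero_apply]

/-- The orthogonality relations for matrix coefficients of an irreducible representation. -/
theorem cosetMean_mul_conj_self {ρ : URep Γ} (hρ : RightInvariant H ρ.mat)
    (hρ' : ρ.IsIrreducible) (i j k l : Fin ρ.dim) :
    cosetMean H (fun g => ρ.mat g i j * conj (ρ.mat g k l)) =
      if i = k ∧ j = l then (ρ.dim : ℂ)⁻¹ else 0 := by
  rw [← intertwiningMean_single_apply]
  obtain ⟨c, hc⟩ := hρ'.exists_eq_smul_one
    (mat_mul_intertwiningMean hρ hρ (Matrix.single j l 1))
  -- The trace is invariant under conjugation by `ρ g`, so averaging preserves it; this determines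
  -- the scalar `c`.
  have htr : (intertwiningMean H ρ ρ (Matrix.single j l 1)).trace = if j = l then 1 else 0 := by
    have h1 := map_cosetMean H (Matrix.traceLinearMap (Fin ρ.dim) ℂ ℂ)
      (fun g => ρ.mat g * Matrix.single j l 1 * (ρ.mat g)ᴴ)
    simp only [Matrix.traceLinearMap_apply] at h1
    rw [intertwiningMean, h1]
    simp only [fun g => Matrix.trace_mul_comm (ρ.mat g * Matrix.single j l (1 : ℂ)) (ρ.mat g)ᴴ,
      ← Matrix.mul_assoc, conjTranspose_mul_mat, Matrix.one_mul, cosetMean_const]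
    split_ifs with h
    · subst h
      rw [Matrix.trace_single_eq_same]
    · rw [Matrix.trace_single_eq_of_ne _ _ _ h]
  have hcd : c = if j = l then (ρ.dim : ℂ)⁻¹ else 0 := by
    rw [hc, Matrix.trace_smul, Matrix.trace_one, smul_eq_mul, Fintype.card_fin] at htr
    rw [← mul_inv_cancel_right₀ ρ.dim_ne_zero c, htr]
    split_ifs <;> simp
  rw [hc, hcd, Matrix.smul_apply, Matrix.one_apply]
  by_cases hik : i = k <;> by_cases hjl : j = l <;> simp [hik, hjl]

end URep

end Schur

/-! ### Completeness of the matrix coefficients. -/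

section Completeness

variable {Γ : Type} [Group Γ]

/-- A nonzero invariant subspace of a finite-dimensional unitary representation contains vectors
`e i` that span an irreducible subrepresentation and in which the latter has unitary matrices. -/
theorem exists_irreducible_of_invariant {F : Type*} [NormedAddCommGroup F] [InnerProductSpace ℂ F]
    [FiniteDimensional ℂ F] (L : Γ →* (F →ₗ[ℂ] F))
    (hL : ∀ x f g, inner ℂ (L x f) (L x g) = inner ℂ f g)
    (Z : Submodule ℂ F) (hZ : ∀ x, ∀ f ∈ Z, L x f ∈ Z) (hZ0 : Z ≠ ⊥) :
    ∃ (σ : URep Γ) (e : Fin σ.dim → F), σ.IsIrreducible ∧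
      (∀ x y, L x = L y → σ.mat x = σ.mat y) ∧ (∀ i, e i ∈ Z) ∧ (∀ i, e i ≠ 0) ∧
      ∀ x j, L x (e j) = ∑ i, σ.mat x i j • e i := by
  -- A minimal nonzero invariant subspace of `Z`; an orthonormal basis of it yields `σ`.
  obtain ⟨V, ⟨hV0, hVZ, hV⟩, hmin⟩ := wellFounded_lt.has_min
    {V : Submodule ℂ F | V ≠ ⊥ ∧ V ≤ Z ∧ ∀ x, ∀ f ∈ V, L x f ∈ V} ⟨Z, hZ0, le_rfl, hZ⟩
  have hpos : 0 < Module.finrank ℂ V :=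
    Nat.pos_of_ne_zero fun h => hV0 (Submodule.finrank_eq_zero.1 h)
  let b := stdOrthonormalBasis ℂ V
  let R : Γ →* (V →ₗ[ℂ] V) :=
    { toFun := fun x => (L x).restrict (hV x)
      map_one' := by ext v; simp
      map_mul' := fun x y => by ext v; simp }
  have hR : ∀ x, star (R x) * R x = 1 := fun x => by
    rw [LinearMap.star_eq_adjoint]
    refine LinearMap.ext fun v => ext_inner_left ℂ fun w => ?_
    rw [Module.End.mul_apply, LinearMap.adjoint_inner_right, Module.End.one_apply]
    exact hL x w v
  let σ : URep Γ :=
    { dim := Module.finrank ℂ V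
      dim_pos := hpos
      hom := ((LinearMap.toMatrixOrthonormal b : _ →* Matrix _ _ ℂ).comp R).codRestrict _
        fun x => by
          rw [Matrix.mem_unitaryGroup_iff']
          simp only [MonoidHom.comp_apply, MonoidHom.coe_coe]
          rw [← map_star, ← map_mul, hR, map_one] }
  have hσ : ∀ x, σ.mat x = LinearMap.toMatrixOrthonormal b (R x) := fun x => rfl
  have hact : ∀ x j, L x (b j : F) = ∑ i, σ.mat x i j • (b i : F) := fun x j => by
    have h1 := b.sum_repr (R x (b j))
    have h2 := congrArg (fun v : V => (v : F)) h1
    simp only [Submodule.coe_sum, Submodule.coe_smul, b.repr_apply_apply] at h2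
    rw [show L x (b j : F) = (R x (b j) : F) from rfl, ← h2]
    refine Finset.sum_congr rfl fun i _ => ?_
    rw [hσ, LinearMap.toMatrixOrthonormal_apply_apply]
  refine ⟨σ, fun i => (b i : F), ?_, fun x y hxy => ?_, fun i => hVZ (b i).2,
    fun i h => b.orthonormal.ne_zero i (Subtype.ext h), hact⟩
  · intro W hW
    -- `ψ` carries coordinate vectors to `V` and intertwines `σ` with `L`, so an invariant `W`
    -- becomes an invariant subspace of `V` and minimality applies.
    let ψ : (Fin σ.dim → ℂ) →ₗ[ℂ] F := V.subtype ∘ₗ b.toBasis.equivFun.symm.toLinearMap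
    have hψ : ∀ w, ψ w = ∑ i, w i • (b i : F) := fun w => by
      change ((b.toBasis.equivFun.symm w : V) : F) = _
      rw [Module.Basis.equivFun_symm_apply, Submodule.coe_sum]
      simp only [Submodule.coe_smul, OrthonormalBasis.coe_toBasis]
      rfl
    have hψinj : Function.Injective ψ :=
      V.injective_subtype.comp b.toBasis.equivFun.symm.injective
    have hψV : ∀ w, ψ w ∈ V := fun w => (b.toBasis.equivFun.symm w).2
    have hψL : ∀ x w, L x (ψ w) = ψ (σ.mat x *ᵥ w) := fun x w => by
      rw [hψ, hψ, map_sum]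
      simp only [map_smul, hact, Matrix.mulVec, dotProduct, Finset.smul_sum, Finset.sum_smul,
        smul_smul]
      rw [Finset.sum_comm]
      simp only [mul_comm]
    by_cases hW0 : W = ⊥
    · exact Or.inl hW0
    · right
      have hle : W.map ψ ≤ V := by
        rintro _ ⟨w, -, rfl⟩
        exact hψV w
      have heq : W.map ψ = V := by
        refine hle.eq_of_not_lt (hmin _ ⟨fun h => hW0 ?_, hle.trans hVZ, ?_⟩)
        · exact (Submodule.map_injective_of_injective hψinj) (by rw [h, Submodule.map_bot])
        · rintro x _ ⟨w, hw, rfl⟩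
          rw [hψL]
          exact ⟨_, hW x w hw, rfl⟩
      refine eq_top_iff.2 fun w _ => ?_
      have : ψ w ∈ W.map ψ := heq ▸ hψV w
      obtain ⟨w', hw', hww⟩ := this
      exact hψinj hww ▸ hw'
  · rw [hσ, hσ]
    congr 1
    exact LinearMap.ext fun v => Subtype.ext (LinearMap.congr_fun hxy (v : F))

/-- The left regular representation of `Γ` on functions on `Γ ⧸ H`. -/
def leftRegular (H : Subgroup Γ) [Fintype (Γ ⧸ H)] :
    Γ →* (EuclideanSpace ℂ (Γ ⧸ H) →ₗ[ℂ] EuclideanSpace ℂ (Γ ⧸ H)) where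
  toFun x :=
    { toFun := fun f => WithLp.toLp 2 fun q => f (x⁻¹ • q)
      map_add' := fun f g => by ext q; simp
      map_smul' := fun c f => by ext q; simp }
  map_one' := by ext f q; simp
  map_mul' x y := by
    refine LinearMap.ext fun f => ?_
    ext q
    simp [mul_smul]

theorem leftRegular_apply (H : Subgroup Γ) [Fintype (Γ ⧸ H)] (x : Γ)
    (f : EuclideanSpace ℂ (Γ ⧸ H)) (q : Γ ⧸ H) : leftRegular H x f q = f (x⁻¹ • q) := rfl

theorem inner_leftRegular (H : Subgroup Γ) [Fintype (Γ ⧸ H)] (x : Γ)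
    (f g : EuclideanSpace ℂ (Γ ⧸ H)) :
    inner ℂ (leftRegular H x f) (leftRegular H x g) = inner ℂ f g := by
  simp only [PiLp.inner_apply, leftRegular_apply]
  exact Equiv.sum_comp (MulAction.toPerm x⁻¹ : Equiv.Perm (Γ ⧸ H)) fun q => inner ℂ (f q) (g q)

theorem leftRegular_mul_mem (H : Subgroup Γ) [H.Normal] [Fintype (Γ ⧸ H)] (x : Γ) {h : Γ}
    (hh : h ∈ H) : leftRegular H (x * h) = leftRegular H x := by
  refine LinearMap.ext fun f => ?_
  ext q
  rw [leftRegular_apply, leftRegular_apply]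
  refine congrArg f.ofLp ?_
  obtain ⟨g, rfl⟩ := QuotientGroup.mk_surjective q
  change ((((x * h)⁻¹ * g : Γ)) : Γ ⧸ H) = ((x⁻¹ * g : Γ) : Γ ⧸ H)
  have h1 : ((h : Γ) : Γ ⧸ H) = 1 := (QuotientGroup.eq_one_iff h).2 hh
  simp [h1]

/-- The functions on `Γ ⧸ H` all of whose Fourier coefficients vanish. -/
def fourierKernel (H : Subgroup Γ) [Fintype (Γ ⧸ H)] :
    Submodule ℂ (EuclideanSpace ℂ (Γ ⧸ H)) where
  carrier := {f | ∀ σ : URep Γ, σ.IsIrreducible → RightInvariant H σ.mat → ∀ i j,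
    cosetMean H (fun g => f (g : Γ ⧸ H) * σ.mat g i j) = 0}
  zero_mem' := fun σ _ _ i j => by simp [cosetMean_eq_sum]
  add_mem' := fun {f g} hf hg σ h1 h2 i j => by
    have hf' := hf σ h1 h2 i j
    have hg' := hg σ h1 h2 i j
    simp only [cosetMean_eq_sum] at hf' hg' ⊢
    simp only [PiLp.add_apply, add_mul, Finset.sum_add_distrib, smul_add, hf', hg', add_zero]
  smul_mem' := fun c f hf σ h1 h2 i j => by
    have hf' := hf σ h1 h2 i j
    simp only [cosetMean_eq_sum] at hf' ⊢
    simp only [PiLp.smul_apply, smul_eq_mul, mul_assoc, ← Finset.mul_sum]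
    rw [smul_eq_mul] at hf'
    rw [mul_left_comm, hf', mul_zero]

theorem rightInvariant_coe {X : Type*} (H : Subgroup Γ) (f : Γ ⧸ H → X) :
    RightInvariant H (fun g => f g) :=
  fun _ _ hh => congrArg f (QuotientGroup.mk_mul_of_mem _ hh)

theorem rightInvariant_entry {X α β : Type*} {H : Subgroup Γ} {f : Γ → Matrix α β X}
    (hf : RightInvariant H f) (i : α) (j : β) : RightInvariant H (fun g => f g i j) :=
  hf.comp fun A => A i j

/-- Translating a function by `x` multiplies its Fourier matrix at `σ` by `σ x` on the left. -/
theorem leftRegular_mem_fourierKernel (H : Subgroup Γ) [Fintype (Γ ⧸ H)] [H.FiniteIndex]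
    (x : Γ) {f : EuclideanSpace ℂ (Γ ⧸ H)} (hf : f ∈ fourierKernel H) :
    leftRegular H x f ∈ fourierKernel H := by
  intro σ h1 h2 i j
  have h3 := cosetMean_left_mul H (f := fun g : Γ => leftRegular H x f (g : Γ ⧸ H) * σ.mat g i j)
    ((rightInvariant_coe H _).comp₂ (rightInvariant_entry h2 i j) (· * ·)) x
  rw [← h3]
  have h4 : ∀ g : Γ, leftRegular H x f ((x * g : Γ) : Γ ⧸ H) * σ.mat (x * g) i j =
      ∑ k, σ.mat x i k * (f (g : Γ ⧸ H) * σ.mat g k j) := fun g => by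
    rw [leftRegular_apply, σ.mat_mul, Matrix.mul_apply, Finset.mul_sum]
    have : (x⁻¹ • ((x * g : Γ) : Γ ⧸ H)) = (g : Γ ⧸ H) := by
      change ((x⁻¹ * (x * g) : Γ) : Γ ⧸ H) = g
      rw [inv_mul_cancel_left]
    rw [this]
    exact Finset.sum_congr rfl fun k _ => by ring
  simp only [h4, cosetMean_sum, cosetMean_mul_left]
  exact Finset.sum_eq_zero fun k _ => by rw [hf σ h1 h2, mul_zero]

/-- The matrix coefficients of the irreducible representations that are trivial on `H` form a
complete system in the space of right `H`-invariant functions. -/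
theorem eq_zero_of_cosetMean_mul_mat_eq_zero (H : Subgroup Γ) [H.Normal] [H.FiniteIndex]
    {f : Γ → ℂ} (hf : RightInvariant H f)
    (h : ∀ σ : URep Γ, σ.IsIrreducible → RightInvariant H σ.mat → ∀ i j,
      cosetMean H (fun g => f g * σ.mat g i j) = 0) : f = 0 := by
  have := H.fintypeQuotientOfFiniteIndex
  have hbot : fourierKernel H = ⊥ := by
    by_contra hne
    obtain ⟨σ, e, hσ, hinv, he, he0, hact⟩ := exists_irreducible_of_invariant (leftRegular H)
      (inner_leftRegular H) (fourierKernel H)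
      (fun x f hf => leftRegular_mem_fourierKernel H x hf) hne
    have hσH : RightInvariant H σ.mat := fun g x hx => hinv _ _ (leftRegular_mul_mem H g hx)
    -- Evaluating the translate of `e 0` by `x⁻¹` at the identity coset exhibits `e 0` as a
    -- combination of conjugate matrix coefficients of `σ`.
    have hexp : ∀ x : Γ, e 0 (x : Γ ⧸ H) =
        ∑ i, conj (σ.mat x 0 i) * e i ((1 : Γ) : Γ ⧸ H) := fun x => by
      have h1 : leftRegular H x⁻¹ (e 0) ((1 : Γ) : Γ ⧸ H) = e 0 (x : Γ ⧸ H) := by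
        rw [leftRegular_apply, inv_inv]
        refine congrArg (e 0).ofLp ?_
        change ((x * 1 : Γ) : Γ ⧸ H) = x
        rw [mul_one]
      rw [← h1, hact, σ.mat_inv]
      simp [Matrix.conjTranspose_apply]
    -- The squared norm of `e 0` is therefore a combination of its own Fourier coefficients, all of
    -- which vanish.
    have h0 := eq_zero_of_cosetMean_mul_conj H (rightInvariant_coe H (e 0)) (by
      have h2 : ∀ g : Γ, e 0 (g : Γ ⧸ H) * starRingEnd ℂ (e 0 (g : Γ ⧸ H)) =
          ∑ i, starRingEnd ℂ (e i ((1 : Γ) : Γ ⧸ H)) *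
            (e 0 (g : Γ ⧸ H) * σ.mat g 0 i) := fun g => by
        rw [congrArg (starRingEnd ℂ) (hexp g), map_sum, Finset.mul_sum]
        refine Finset.sum_congr rfl fun i _ => ?_
        rw [map_mul, Complex.conj_conj]
        ring
      simp only [h2, cosetMean_sum, cosetMean_mul_left]
      exact Finset.sum_eq_zero fun i _ => by rw [he 0 σ hσ hσH, mul_zero])
    refine he0 0 ?_
    ext q
    obtain ⟨g, rfl⟩ := QuotientGroup.mk_surjective q
    exact congrFun h0 g
  have hmem : WithLp.toLp 2 (fun q : Γ ⧸ H => f q.out) ∈ fourierKernel H := by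
    intro σ h1 h2 i j
    rw [← h σ h1 h2 i j]
    congr 1
    funext g
    change f ((g : Γ ⧸ H).out) * _ = _
    rw [hf.out_mk]
  rw [hbot, Submodule.mem_bot] at hmem
  funext g
  rw [← hf.out_mk g]
  exact congrArg (fun v : EuclideanSpace ℂ (Γ ⧸ H) => v (g : Γ ⧸ H)) hmem

end Completeness

/-! ### Fourier inversion and Plancherel at a fixed level. -/

section Fourier

variable {Γ : Type} [Group Γ]

namespace URep

theorem Equivalent.refl (ρ : URep Γ) : ρ.Equivalent ρ :=
  ⟨rfl, 1, by simp, by simp, fun g => by simp⟩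

theorem Equivalent.rightInvariant {ρ σ : URep Γ} (h : ρ.Equivalent σ) {H : Subgroup Γ}
    (hσ : RightInvariant H σ.mat) : RightInvariant H ρ.mat := by
  obtain ⟨-, U, -, hU, hρσ⟩ := h
  have h1 : ∀ g, ρ.mat g = U * σ.mat g * Uᴴ := fun g => by
    rw [← hρσ, Matrix.mul_assoc Uᴴ, ← Matrix.mul_assoc, hU, Matrix.one_mul,
      Matrix.mul_assoc, hU, Matrix.mul_one]
  intro g x hx
  rw [h1, h1, hσ g x hx]

/-- An irreducible representation that is not trivial on the normal subgroup `H` has no nonzero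
`H`-fixed vectors. -/
theorem IsIrreducible.eq_zero_of_fixed {ρ : URep Γ} (hρ : ρ.IsIrreducible) {H : Subgroup Γ}
    [hH : H.Normal] (hne : ¬ RightInvariant H ρ.mat) {w : Fin ρ.dim → ℂ}
    (hw : ∀ h ∈ H, ρ.mat h *ᵥ w = w) : w = 0 := by
  let W : Submodule ℂ (Fin ρ.dim → ℂ) :=
    { carrier := {w | ∀ h ∈ H, ρ.mat h *ᵥ w = w}
      zero_mem' := fun h _ => Matrix.mulVec_zero _
      add_mem' := fun {a b} ha hb h hh => by rw [Matrix.mulVec_add, ha h hh, hb h hh]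
      smul_mem' := fun c a ha h hh => by rw [Matrix.mulVec_smul, ha h hh] }
  have hinv : ∀ g, ∀ w ∈ W, ρ.mat g *ᵥ w ∈ W := fun g w hw h hh => by
    have h1 : h * g = g * (g⁻¹ * h * g) := by group
    have h2 : g⁻¹ * h * g ∈ H := by simpa using hH.conj_mem h hh g⁻¹
    rw [Matrix.mulVec_mulVec, ← ρ.mat_mul, h1, ρ.mat_mul, ← Matrix.mulVec_mulVec, hw _ h2]
  rcases hρ W hinv with h | h
  · exact (Submodule.eq_bot_iff W).1 h w hw
  · refine absurd (fun g x hx => ?_) hne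
    have h1 : ρ.mat x = 1 := Matrix.ext_of_mulVec_single fun i => by
      rw [Matrix.one_mulVec]
      exact (h ▸ Submodule.mem_top : Pi.single i 1 ∈ W) x hx
    rw [ρ.mat_mul, h1, Matrix.mul_one]

end URep

/-- By normality `f` is also left `H`-invariant, so substituting `h * g` for `g` shows that each
column of the transform is fixed by `ρ h` for all `h ∈ H`; such vectors vanish. -/
theorem cosetMean_mul_mat_eq_zero {H K : Subgroup Γ} [H.Normal] [K.FiniteIndex] (hK : K ≤ H)
    {f : Γ → ℂ} (hf : RightInvariant H f) {ρ : URep Γ} (hρ : ρ.IsIrreducible)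
    (hρK : RightInvariant K ρ.mat) (hne : ¬ RightInvariant H ρ.mat) (i j : Fin ρ.dim) :
    cosetMean K (fun g => f g * ρ.mat g i j) = 0 := by
  have hw : (fun i => cosetMean K (fun g => f g * ρ.mat g i j)) = 0 := by
    refine hρ.eq_zero_of_fixed hne fun h hh => ?_
    funext i
    have h1 := cosetMean_left_mul K (f := fun g => f g * ρ.mat g i j)
      ((hf.mono hK).comp₂ (rightInvariant_entry hρK i j) (· * ·)) h
    rw [← h1]
    have h2 : ∀ g, f (h * g) * ρ.mat (h * g) i j =
        ∑ k, ρ.mat h i k * (f g * ρ.mat g k j) := fun g => by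
      rw [hf.left_mul_mem hh, ρ.mat_mul, Matrix.mul_apply, Finset.mul_sum]
      exact Finset.sum_congr rfl fun k _ => by ring
    simp only [h2, cosetMean_sum, cosetMean_mul_left]
    rfl
  exact congrFun hw i

/-- `E` is a system of pairwise inequivalent irreducible representations of `Γ`. -/
def IsInequivalentSystem (E : Set (URep Γ)) : Prop :=
  (∀ ρ ∈ E, ρ.IsIrreducible) ∧ ∀ ρ ∈ E, ∀ σ ∈ E, ρ.Equivalent σ → ρ = σ

/-- The representations in `E` that are trivial on `H`. -/
def trivialOn (E : Set (URep Γ)) (H : Subgroup Γ) : Set (URep Γ) :=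
  {ρ | ρ ∈ E ∧ RightInvariant H ρ.mat}

/-- The `(0, 0)` coefficients of these representations are nonzero and pairwise orthogonal in the
finite-dimensional space of functions on `Γ ⧸ H`. -/
theorem finite_trivialOn {E : Set (URep Γ)} (hE : IsInequivalentSystem E) (H : Subgroup Γ)
    [H.FiniteIndex] : (trivialOn E H).Finite := by
  have := H.fintypeQuotientOfFiniteIndex
  have hc : (Nat.card (Γ ⧸ H) : ℂ)⁻¹ ≠ 0 := inv_ne_zero (Nat.cast_ne_zero.2 Nat.card_pos.ne')
  let v : trivialOn E H → EuclideanSpace ℂ (Γ ⧸ H) := fun ρ =>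
    WithLp.toLp 2 fun q => ρ.1.mat q.out 0 0
  have hv : ∀ ρ σ, (Nat.card (Γ ⧸ H) : ℂ)⁻¹ * inner ℂ (v ρ) (v σ) =
      cosetMean H fun g => σ.1.mat g 0 0 * conj (ρ.1.mat g 0 0) := fun ρ σ => by
    rw [cosetMean_eq_sum, smul_eq_mul, PiLp.inner_apply]
    rfl
  have hli : LinearIndependent ℂ v := by
    refine linearIndependent_of_ne_zero_of_inner_eq_zero (fun ρ h => ?_) fun ρ σ hne => ?_
    · have h1 := hv ρ ρ
      rw [h, inner_zero_left, mul_zero,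
        URep.cosetMean_mul_conj_self ρ.2.2 (hE.1 _ ρ.2.1), if_pos ⟨rfl, rfl⟩] at h1
      exact inv_ne_zero ρ.1.dim_ne_zero h1.symm
    · refine (mul_eq_zero.1 ((hv ρ σ).trans ?_)).resolve_left hc
      exact URep.cosetMean_mul_conj_eq_zero σ.2.2 ρ.2.2 (hE.1 _ σ.2.1) (hE.1 _ ρ.2.1)
        (fun h => hne (Subtype.ext (hE.2 _ σ.2.1 _ ρ.2.1 h).symm)) 0 0 0 0
  exact Set.finite_coe_iff.1 hli.finite

/-- The function with prescribed Fourier coefficients `B ρ`, `ρ ∈ s`. -/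
def synthesis (s : Finset (URep Γ)) (B : ∀ ρ : URep Γ, Matrix (Fin ρ.dim) (Fin ρ.dim) ℂ)
    (g : Γ) : ℂ :=
  ∑ ρ ∈ s, ∑ i, ∑ j, (ρ.dim * B ρ i j) * conj (ρ.mat g i j)

theorem rightInvariant_synthesis {s : Finset (URep Γ)} {H : Subgroup Γ}
    (hs : ∀ ρ ∈ s, RightInvariant H ρ.mat)
    (B : ∀ ρ : URep Γ, Matrix (Fin ρ.dim) (Fin ρ.dim) ℂ) :
    RightInvariant H (synthesis s B) := fun g h hh =>
  Finset.sum_congr rfl fun ρ hρ => by rw [hs ρ hρ g h hh]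

theorem cosetMean_synthesis {E : Set (URep Γ)} (hE : IsInequivalentSystem E) {H : Subgroup Γ}
    [H.FiniteIndex] {s : Finset (URep Γ)} (hs : ∀ ρ ∈ s, ρ ∈ trivialOn E H)
    (B : ∀ ρ : URep Γ, Matrix (Fin ρ.dim) (Fin ρ.dim) ℂ) {σ : URep Γ} (hσ : σ ∈ trivialOn E H)
    (k l : Fin σ.dim) [Decidable (σ ∈ s)] :
    cosetMean H (fun g => synthesis s B g * σ.mat g k l) = if σ ∈ s then B σ k l else 0 := by
  have h1 : ∀ g, synthesis s B g * σ.mat g k l =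
      ∑ ρ ∈ s, ∑ i, ∑ j, (ρ.dim * B ρ i j) * (σ.mat g k l * conj (ρ.mat g i j)) := fun g => by
    simp only [synthesis, Finset.sum_mul]
    exact Finset.sum_congr rfl fun ρ _ => Finset.sum_congr rfl fun i _ =>
      Finset.sum_congr rfl fun j _ => by ring
  simp only [h1, cosetMean_sum, cosetMean_mul_left]
  have h2 : ∀ ρ ∈ s, ρ ≠ σ → ∑ i, ∑ j, (ρ.dim * B ρ i j) *
      cosetMean H (fun g => σ.mat g k l * conj (ρ.mat g i j)) = 0 := fun ρ hρ hne =>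
    Finset.sum_eq_zero fun i _ => Finset.sum_eq_zero fun j _ => by
      rw [URep.cosetMean_mul_conj_eq_zero hσ.2 (hs ρ hρ).2 (hE.1 _ hσ.1) (hE.1 _ (hs ρ hρ).1)
        (fun h => hne (hE.2 _ hσ.1 _ (hs ρ hρ).1 h).symm), mul_zero]
  split_ifs with hmem
  · rw [Finset.sum_eq_single_of_mem σ hmem h2]
    simp only [URep.cosetMean_mul_conj_self hσ.2 (hE.1 _ hσ.1), ite_and]
    simp [mul_comm, σ.dim_ne_zero]
  · exact Finset.sum_eq_zero fun ρ hρ => h2 ρ hρ fun h => hmem (h ▸ hρ)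

/-- Every irreducible representation that is trivial on `H` is equivalent to one in `E`. -/
def ExhaustsTrivialOn (E : Set (URep Γ)) (H : Subgroup Γ) : Prop :=
  ∀ σ : URep Γ, σ.IsIrreducible → RightInvariant H σ.mat → ∃ ρ ∈ E, ρ.Equivalent σ

variable {E : Set (URep Γ)} {H : Subgroup Γ} [H.Normal] [H.FiniteIndex]

/-- Matrix coefficients of `σ` are linear combinations of those of its representative in `E`, so
testing against `E` suffices for completeness. -/
theorem eq_zero_of_forall_mem_trivialOn (hE' : ExhaustsTrivialOn E H) {f : Γ → ℂ}
    (hf : RightInvariant H f) (h : ∀ ρ ∈ trivialOn E H, ∀ i j,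
      cosetMean H (fun g => f g * ρ.mat g i j) = 0) : f = 0 := by
  refine eq_zero_of_cosetMean_mul_mat_eq_zero H hf fun σ hσ hσH i j => ?_
  obtain ⟨ρ, hρ, hρσ⟩ := hE' σ hσ hσH
  have hρH := hρσ.rightInvariant hσH
  obtain ⟨-, U, -, -, hU⟩ := hρσ
  have h1 : ∀ g, f g * σ.mat g i j =
      ∑ l, ∑ k, (Uᴴ i k * U l j) * (f g * ρ.mat g k l) := fun g => by
    rw [← hU]
    simp only [Matrix.mul_apply, Finset.mul_sum, Finset.sum_mul]
    exact Finset.sum_congr rfl fun l _ => Finset.sum_congr rfl fun k _ => by ring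
  simp only [h1, cosetMean_sum, cosetMean_mul_left, h ρ ⟨hρ, hρH⟩, mul_zero,
    Finset.sum_const_zero]

/-- Fourier inversion. -/
theorem synthesis_cosetMean (hE : IsInequivalentSystem E) (hE' : ExhaustsTrivialOn E H)
    {f : Γ → ℂ} (hf : RightInvariant H f) :
    synthesis (finite_trivialOn hE H).toFinset
      (fun ρ => Matrix.of fun i j => cosetMean H fun g => f g * ρ.mat g i j) = f := by
  classical
  have hs : ∀ ρ ∈ (finite_trivialOn hE H).toFinset, ρ ∈ trivialOn E H := fun ρ hρ =>
    (Set.Finite.mem_toFinset _).1 hρ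
  set B : ∀ ρ : URep Γ, Matrix (Fin ρ.dim) (Fin ρ.dim) ℂ :=
    fun ρ => Matrix.of fun i j => cosetMean H fun g => f g * ρ.mat g i j with hB
  have hsyn := rightInvariant_synthesis (fun ρ hρ => (hs ρ hρ).2) B
  rw [← sub_eq_zero]
  -- Orthogonality gives both functions the same coefficients, so completeness kills the difference.
  refine eq_zero_of_forall_mem_trivialOn hE' (hsyn.comp₂ hf (· - ·)) fun ρ hρ i j => ?_
  have h1 : cosetMean H (fun g => (synthesis (finite_trivialOn hE H).toFinset B g - f g) *
      ρ.mat g i j) =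
      cosetMean H (fun g => synthesis (finite_trivialOn hE H).toFinset B g * ρ.mat g i j) -
      cosetMean H (fun g => f g * ρ.mat g i j) := by
    have := H.fintypeQuotientOfFiniteIndex
    simp only [cosetMean_eq_sum, sub_mul, Finset.sum_sub_distrib, smul_sub]
  refine h1.trans ?_
  rw [cosetMean_synthesis hE hs B hρ, if_pos ((Set.Finite.mem_toFinset _).2 hρ), hB]
  exact sub_self _

/-- Expand `f` by Fourier inversion; the mean of each conjugate matrix coefficient against `conj f'`
is the conjugate of a coefficient of `f'`. -/
theorem cosetMean_mul_conj (hE : IsInequivalentSystem E) (hE' : ExhaustsTrivialOn E H)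
    {f f' : Γ → ℂ} (hf : RightInvariant H f) :
    cosetMean H (fun g => f g * conj (f' g)) =
      ∑ ρ ∈ (finite_trivialOn hE H).toFinset, ∑ i, ∑ j,
        ρ.dim * (cosetMean H (fun g => f g * ρ.mat g i j) *
          conj (cosetMean H (fun g => f' g * ρ.mat g i j))) := by
  conv_lhs => rw [← synthesis_cosetMean hE hE' hf]
  simp only [synthesis, Finset.sum_mul, cosetMean_sum]
  refine Finset.sum_congr rfl fun ρ _ => Finset.sum_congr rfl fun i _ =>
    Finset.sum_congr rfl fun j _ => ?_
  rw [conj_cosetMean, ← mul_assoc, ← cosetMean_mul_left]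
  congr 1
  funext g
  rw [map_mul, Matrix.of_apply]
  ring

theorem cosetMean_kronecker_apply {m n : ℕ} (u : Γ → Matrix (Fin m) (Fin n) ℂ) (ρ : URep Γ)
    (a : Fin m) (b : Fin n) (i j : Fin ρ.dim) {H : Subgroup Γ} [H.FiniteIndex] :
    cosetMean H (fun g => u g ⊗ₖ ρ.mat g) (a, i) (b, j) =
      cosetMean H (fun g => u g a b * ρ.mat g i j) :=
  cosetMean_apply H _ _ _

/-- Plancherel's formula for right `H`-invariant functions. -/
theorem cosetMean_frobenius (hE : IsInequivalentSystem E) (hE' : ExhaustsTrivialOn E H)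
    {m n : ℕ} {u v : Γ → Matrix (Fin m) (Fin n) ℂ} (hu : RightInvariant H u) :
    cosetMean H (fun g => frobenius (u g) (v g)) =
      ∑ ρ ∈ (finite_trivialOn hE H).toFinset, ρ.dim *
        frobenius (cosetMean H fun g => u g ⊗ₖ ρ.mat g) (cosetMean H fun g => v g ⊗ₖ ρ.mat g) := by
  have h1 : ∀ a b, RightInvariant H (fun g => u g a b) := rightInvariant_entry hu
  simp only [frobenius, cosetMean_sum, Fintype.sum_prod_type, cosetMean_kronecker_apply,
    cosetMean_mul_conj hE hE' (h1 _ _), Finset.mul_sum]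
  simp only [Finset.sum_comm (s := (Finset.univ : Finset (Fin _)))
    (t := (finite_trivialOn hE H).toFinset)]
  refine Finset.sum_congr rfl fun ρ _ => Finset.sum_congr rfl fun a _ => ?_
  rw [Finset.sum_comm]

end Fourier

/-! ### Admissible exponents, for an abstract homomorphism `π`. -/

section Exponents

variable {Γ Q : Type} [Group Γ] [Group Q] {π : Γ →* Q} {A : Subgroup Q} {T : Set Γ}

/-- Because `A` is torsion-free, `t ^ N ∈ ker π` forces `π t = 1`. The identity is also some `s ^ N`
with `π s = 1`, and injectivity of `π` on `T` gives `t = s`. -/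
theorem eq_one_of_map_eq_one (hT : Set.BijOn π T A)
    (htf : ∀ a ∈ A, ∀ n : ℕ, 0 < n → a ^ n = 1 → a = 1) {N : ℕ} (hN : 0 < N)
    {H : Subgroup Γ} (hH : (H : Set Γ) = powSet T N) {x : Γ} (hx : x ∈ H) (h1 : π x = 1) :
    x = 1 := by
  have hx' : x ∈ powSet T N := hH ▸ hx
  have h1' : (1 : Γ) ∈ powSet T N := hH ▸ H.one_mem
  obtain ⟨t, ht, rfl⟩ := hx'
  obtain ⟨s, hs, hs1⟩ := h1'
  simp only [map_pow] at h1 hs1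
  have h2 : π t = 1 := htf _ (hT.mapsTo ht) N hN h1
  have h3 : π s = 1 := htf _ (hT.mapsTo hs) N hN (by rw [← map_pow, hs1, map_one])
  rw [hT.injOn ht hs (h2.trans h3.symm)]
  exact hs1

/-- Commutators in `H` map to `1` in the commutative `A`, and `π` is injective on `H`. -/
theorem commute_of_mem_powSet (hT : Set.BijOn π T A)
    (htf : ∀ a ∈ A, ∀ n : ℕ, 0 < n → a ^ n = 1 → a = 1)
    (hcomm : ∀ a ∈ A, ∀ b ∈ A, a * b = b * a) {N : ℕ} (hN : 0 < N)
    {H : Subgroup Γ} (hH : (H : Set Γ) = powSet T N) {x y : Γ} (hx : x ∈ H) (hy : y ∈ H) :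
    Commute x y := by
  have hA : ∀ z ∈ H, π z ∈ A := fun z hz => by
    have hz' : z ∈ powSet T N := hH ▸ hz
    obtain ⟨t, ht, rfl⟩ := hz'
    simp only [map_pow]
    exact A.pow_mem (hT.mapsTo ht) N
  have h1 := eq_one_of_map_eq_one hT htf hN hH
    (H.mul_mem (H.mul_mem hx hy) (H.inv_mem (H.mul_mem hy hx)))
    (by rw [map_mul, map_inv, map_mul, map_mul, hcomm _ (hA x hx) _ (hA y hy), mul_inv_cancel])
  exact mul_inv_eq_one.1 h1

theorem powSet_mul (T : Set Γ) (M N : ℕ) :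
    powSet T (M * N) = (fun x => x ^ N) '' powSet T M := by
  simp only [powSet, Set.image_image, pow_mul]

theorem powSet_mul_subset_left {H : Subgroup Γ} {M : ℕ} (hH : (H : Set Γ) = powSet T M) (N : ℕ) :
    powSet T (M * N) ⊆ powSet T M := by
  rw [powSet_mul, ← hH]
  rintro _ ⟨x, hx, rfl⟩
  exact H.pow_mem hx N

/-- `T^(M * N)` consists of the `N`-th powers in the commutative normal subgroup `T^M`, so it is
again a normal subgroup. -/
theorem mul_mem_goodExponents (hT : Set.BijOn π T A)
    (htf : ∀ a ∈ A, ∀ n : ℕ, 0 < n → a ^ n = 1 → a = 1)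
    (hcomm : ∀ a ∈ A, ∀ b ∈ A, a * b = b * a) {M N : ℕ} (hM : M ∈ goodExponents T)
    (hN : 0 < N) : M * N ∈ goodExponents T := by
  obtain ⟨hM0, H, hHn, hH⟩ := hM
  refine ⟨Nat.mul_pos hM0 hN, ?_⟩
  let K : Subgroup Γ :=
    { carrier := (fun x => x ^ N) '' (H : Set Γ)
      one_mem' := ⟨1, H.one_mem, one_pow N⟩
      mul_mem' := by
        rintro _ _ ⟨x, hx, rfl⟩ ⟨y, hy, rfl⟩
        exact ⟨x * y, H.mul_mem hx hy,
          (commute_of_mem_powSet hT htf hcomm hM0 hH hx hy).mul_pow N⟩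
      inv_mem' := by
        rintro _ ⟨x, hx, rfl⟩
        exact ⟨x⁻¹, H.inv_mem hx, inv_pow x N⟩ }
  refine ⟨K, ⟨?_⟩, ?_⟩
  · rintro _ ⟨x, hx, rfl⟩ g
    exact ⟨g * x * g⁻¹, hHn.conj_mem x hx g, conj_pow⟩
  · rw [powSet_mul, ← hH]
    rfl

/-- If `t` centralizes `K` and the commutator of `t` and `s` lies in `K`, then `t ^ |K|` commutes
with `s`. -/
theorem commute_pow_card {K : Subgroup Γ} {t s : Γ} (hc : t * s * t⁻¹ * s⁻¹ ∈ K)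
    (htK : ∀ k ∈ K, Commute t k) : Commute (t ^ Nat.card K) s := by
  set c := t * s * t⁻¹ * s⁻¹ with hcdef
  have h1 : t * s * t⁻¹ = c * s := by rw [hcdef]; group
  have h2 : ∀ n : ℕ, t ^ n * s * (t ^ n)⁻¹ = c ^ n * s := by
    intro n
    induction n with
    | zero => simp
    | succ n ih =>
      have h3 : t * c ^ n * t⁻¹ = c ^ n := by
        rw [((htK c hc).pow_right n).eq, mul_inv_cancel_right]
      calc t ^ (n + 1) * s * (t ^ (n + 1))⁻¹ = t * (t ^ n * s * (t ^ n)⁻¹) * t⁻¹ := by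
            rw [pow_succ']; group
        _ = (t * c ^ n * t⁻¹) * (t * s * t⁻¹) := by rw [ih]; group
        _ = c ^ (n + 1) * s := by rw [h3, h1, pow_succ, ← mul_assoc]
  have h4 : c ^ Nat.card K = 1 := by
    have := pow_card_eq_one' (G := K) (x := ⟨c, hc⟩)
    exact congrArg Subtype.val this
  have h5 := h2 (Nat.card K)
  rw [h4, one_mul, mul_inv_eq_iff_eq_mul] at h5
  exact h5

/-- If `π` has finite kernel, then `T ^ N` is a normal subgroup for some positive `N`. -/
theorem goodExponents_nonempty (hT : Set.BijOn π T A)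
    (hcomm : ∀ a ∈ A, ∀ b ∈ A, a * b = b * a)
    (hnorm : ∀ g, ∀ a ∈ A, π g * a * (π g)⁻¹ ∈ A) [Finite π.ker] :
    (goodExponents T).Nonempty := by
  set a := Nat.card (MulAut π.ker) with ha
  set n := Nat.card π.ker with hn
  have hn0 : 0 < n := Nat.card_pos
  have ha0 : 0 < a := Nat.card_pos
  -- Conjugation by `x` is an element of a finite automorphism group of order `a`.
  have hconj : ∀ x : Γ, ∀ k ∈ π.ker, Commute (x ^ a) k := fun x k hk => by
    have h1 : (MulAut.conjNormal x : MulAut π.ker) ^ a = 1 := pow_card_eq_one'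
    rw [← map_pow] at h1
    have h2 := congrArg (fun f : MulAut π.ker => ((f ⟨k, hk⟩ : π.ker) : Γ)) h1
    simp only [MulAut.conjNormal_apply, MulAut.one_apply] at h2
    exact mul_inv_eq_iff_eq_mul.1 h2
  -- The commutator of `x ^ a` and `y` lies in `ker π`, which `x ^ a` centralizes, so a further
  -- power `n` removes it.
  have hcent : ∀ x y : Γ, π x ∈ A → π y ∈ A → Commute (x ^ (a * n)) y := fun x y hx hy => by
    rw [pow_mul]
    refine commute_pow_card ?_ (hconj x)
    rw [MonoidHom.mem_ker, map_mul, map_mul, map_mul, map_inv, map_inv,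
      hcomm _ (by rw [map_pow]; exact A.pow_mem hx a) _ hy]
    group
  have hcard : ∀ k ∈ π.ker, k ^ n = 1 := fun k hk =>
    congrArg Subtype.val (pow_card_eq_one' (G := π.ker) (x := ⟨k, hk⟩))
  -- At exponent `a * n` multiplicativity holds up to a factor `k ∈ ker π`; the factors commute, and
  -- the second `n` gives `k ^ n = 1`.
  have hmul : ∀ x y : Γ, π x ∈ A → π y ∈ A →
      (x * y) ^ (a * n * n) = x ^ (a * n * n) * y ^ (a * n * n) := fun x y hx hy => by
    have hxy : π (x * y) ∈ A := by rw [map_mul]; exact A.mul_mem hx hy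
    have hk : (y ^ (a * n))⁻¹ * (x ^ (a * n))⁻¹ * (x * y) ^ (a * n) ∈ π.ker := by
      have h1 : Commute (π x) (π y) := hcomm _ hx _ hy
      simp only [MonoidHom.mem_ker, map_mul, map_pow, map_inv, h1.mul_pow]
      group
    set k := (y ^ (a * n))⁻¹ * (x ^ (a * n))⁻¹ * (x * y) ^ (a * n) with hkdef
    have h2 : (x * y) ^ (a * n) = x ^ (a * n) * (y ^ (a * n) * k) := by rw [hkdef]; group
    have hkA : π k ∈ A := by rw [MonoidHom.mem_ker.1 hk]; exact A.one_mem
    have hyA : π (y ^ (a * n) * k) ∈ A := by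
      rw [map_mul, map_pow]; exact A.mul_mem (A.pow_mem hy _) hkA
    rw [pow_mul, h2, (hcent x _ hx hyA).mul_pow, (hcent y _ hy hkA).mul_pow, hcard k hk, mul_one,
      ← pow_mul, ← pow_mul]
  -- The power map kills `ker π`, so it depends only on the image under `π`. Hence `T^(a * n * n)`
  -- is the set of such powers of all elements over `A`, whatever section `T` is.
  have hpow : ∀ x y : Γ, π x ∈ A → π x = π y → x ^ (a * n * n) = y ^ (a * n * n) :=
    fun x y hx hxy => by
    have hk : y⁻¹ * x ∈ π.ker := by rw [MonoidHom.mem_ker, map_mul, map_inv, hxy, inv_mul_cancel]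
    have h1 := hmul y (y⁻¹ * x) (hxy ▸ hx) (by rw [MonoidHom.mem_ker.1 hk]; exact A.one_mem)
    rw [mul_inv_cancel_left, mul_comm (a * n) n, pow_mul (y⁻¹ * x), hcard _ hk, one_pow,
      mul_one] at h1
    rw [mul_comm (a * n) n, h1]
  have himage : ∀ x : Γ, π x ∈ A → x ^ (a * n * n) ∈ powSet T (a * n * n) := fun x hx => by
    obtain ⟨t, ht, hxt⟩ := hT.surjOn hx
    exact ⟨t, ht, (hpow x t hx hxt.symm).symm⟩
  let H : Subgroup Γ :=
    { carrier := powSet T (a * n * n)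
      one_mem' := by
        simpa using himage 1 (by rw [map_one]; exact A.one_mem)
      mul_mem' := by
        rintro _ _ ⟨x, hx, rfl⟩ ⟨y, hy, rfl⟩
        have hxA := hT.mapsTo hx
        have hyA := hT.mapsTo hy
        have := himage (x * y) (by rw [map_mul]; exact A.mul_mem hxA hyA)
        rwa [hmul x y hxA hyA] at this
      inv_mem' := by
        rintro _ ⟨x, hx, rfl⟩
        have := himage x⁻¹ (by rw [map_inv]; exact A.inv_mem (hT.mapsTo hx))
        rwa [inv_pow] at this }
  refine ⟨a * n * n, Nat.mul_pos (Nat.mul_pos ha0 hn0) hn0, H, ⟨?_⟩, rfl⟩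
  rintro _ ⟨x, hx, rfl⟩ g
  have := himage (g * x * g⁻¹) (by
    rw [map_mul, map_mul, map_inv]; exact hnorm g _ (hT.mapsTo hx))
  rwa [conj_pow] at this

end Exponents

/-! ### Discreteness, compactness and finite index. -/

section Geometry

namespace Euc

variable {ι : Type} [Fintype ι] [DecidableEq ι]

theorem isInducing_coe :
    Topology.IsInducing (fun g : Euc ι => ((g.rot : Matrix ι ι ℝ), g.trans)) := ⟨rfl⟩

theorem coe_injective :
    Function.Injective (fun g : Euc ι => ((g.rot : Matrix ι ι ℝ), g.trans)) := fun g h hgh => by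
  obtain ⟨h1, h2⟩ := Prod.mk.inj hgh
  exact Euc.ext (Subtype.ext h1) h2

theorem continuous_rot : Continuous fun g : Euc ι => (g.rot : Matrix ι ι ℝ) :=
  continuous_fst.comp isInducing_coe.continuous

theorem continuous_trans : Continuous fun g : Euc ι => g.trans :=
  continuous_snd.comp isInducing_coe.continuous

instance : T2Space (Euc ι) :=
  T2Space.of_injective_continuous coe_injective isInducing_coe.continuous

instance : IsTopologicalGroup (Euc ι) where
  continuous_mul := isInducing_coe.continuous_iff.2 <| by
    refine Continuous.prodMk ?_ ?_
    · exact (continuous_rot.comp continuous_fst).matrix_mul (continuous_rot.comp continuous_snd)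
    · exact (continuous_trans.comp continuous_fst).add
        ((continuous_rot.comp continuous_fst).matrix_mulVec (continuous_trans.comp continuous_snd))
  continuous_inv := isInducing_coe.continuous_iff.2 <| by
    refine Continuous.prodMk ?_ ?_
    · exact continuous_rot.matrix_transpose
    · exact (continuous_rot.matrix_transpose.matrix_mulVec continuous_trans).neg

/-- Orthogonal matrices have entries in `[-1, 1]`, so the image in matrices times vectors is closed
inside a compact box. -/
theorem isCompact_setOf_abs_trans_le (R : ℝ) : IsCompact {g : Euc ι | ∀ i, |g.trans i| ≤ R} := by
  rw [isInducing_coe.isCompact_iff]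
  have h1 : (fun g : Euc ι => ((g.rot : Matrix ι ι ℝ), g.trans)) '' {g | ∀ i, |g.trans i| ≤ R} =
      {p : Matrix ι ι ℝ × (ι → ℝ) | p.1 * p.1ᵀ = 1 ∧ ∀ i, |p.2 i| ≤ R} := by
    ext ⟨M, v⟩
    constructor
    · rintro ⟨g, hg, h⟩
      obtain ⟨rfl, rfl⟩ := Prod.mk.inj h
      exact ⟨(Matrix.mem_orthogonalGroup_iff _ _).1 g.rot.2, hg⟩
    · rintro ⟨hM, hv⟩
      exact ⟨⟨⟨M, (Matrix.mem_orthogonalGroup_iff _ _).2 hM⟩, v⟩, hv, rfl⟩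
  rw [h1]
  have hK : IsCompact ((Set.univ.pi fun _ : ι => Set.univ.pi fun _ : ι => Set.Icc (-1 : ℝ) 1) ×ˢ
      (Set.univ.pi fun _ : ι => Set.Icc (-R) R)) :=
    (isCompact_univ_pi fun _ => isCompact_univ_pi fun _ => isCompact_Icc).prod
      (isCompact_univ_pi fun _ => isCompact_Icc)
  refine IsCompact.of_isClosed_subset (X := Matrix ι ι ℝ × (ι → ℝ)) hK ?_ ?_
  · refine IsClosed.inter ?_ ?_
    · exact isClosed_eq (continuous_fst.matrix_mul continuous_fst.matrix_transpose)
        continuous_const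
    · have h2 : IsClosed (⋂ i : ι, {p : Matrix ι ι ℝ × (ι → ℝ) | |p.2 i| ≤ R}) :=
        isClosed_iInter fun i =>
          isClosed_le ((continuous_apply i).comp continuous_snd).abs continuous_const
      have h3 : {p : Matrix ι ι ℝ × (ι → ℝ) | ∀ i, |p.2 i| ≤ R} =
          ⋂ i : ι, {p : Matrix ι ι ℝ × (ι → ℝ) | |p.2 i| ≤ R} := by
        ext p
        simp [Set.mem_iInter]
      rw [← h3] at h2
      exact h2
  · rintro ⟨M, v⟩ ⟨hM, hv⟩
    refine ⟨fun i _ j _ => ?_, fun i _ => abs_le.1 (hv i)⟩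
    have := entry_norm_bound_of_unitary (𝕜 := ℝ) ((Matrix.mem_orthogonalGroup_iff _ _).2 hM) i j
    exact abs_le.1 this

theorem finite_setOf_abs_trans_le (G : Subgroup (Euc ι)) [DiscreteTopology G] (R : ℝ) :
    {g : G | ∀ i, |(g : Euc ι).trans i| ≤ R}.Finite := by
  have h1 : IsCompact ({g : Euc ι | ∀ i, |g.trans i| ≤ R} ∩ G) :=
    (isCompact_setOf_abs_trans_le R).inter_right G.isClosed_of_discrete
  have h2 : ({g : Euc ι | ∀ i, |g.trans i| ≤ R} ∩ G).Finite :=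
    h1.finite (IsDiscrete.mono (s := (G : Set (Euc ι))) ⟨inferInstance⟩ Set.inter_subset_right)
  exact Set.Finite.of_finite_image (f := Subtype.val) (h2.subset (by
    rintro _ ⟨g, hg, rfl⟩
    exact ⟨hg, g.2⟩)) Subtype.val_injective.injOn

theorem trans_mul_of_rot_eq_one {g : Euc ι} (hg : g.rot = 1) (h : Euc ι) :
    (g * h).trans = g.trans + h.trans := by
  rw [mul_def, hg]
  simp

theorem trans_pow_of_mem_translations {g : Euc ι} (hg : g ∈ translations ι) (n : ℕ) :
    (g ^ n).trans = n • g.trans := by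
  induction n with
  | zero => rw [pow_zero, zero_smul]; rfl
  | succ n ih =>
    have h1 : g ^ n ∈ translations ι := (translations ι).pow_mem hg n
    rw [pow_succ, trans_mul_of_rot_eq_one h1, ih, succ_nsmul]

theorem mul_comm_of_mem_translations {g h : Euc ι} (hg : g ∈ translations ι)
    (hh : h ∈ translations ι) : g * h = h * g := by
  refine Euc.ext ?_ ?_
  · change g.rot * h.rot = h.rot * g.rot
    rw [show g.rot = 1 from hg, show h.rot = 1 from hh]
  · rw [trans_mul_of_rot_eq_one hg, trans_mul_of_rot_eq_one hh, add_comm]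

theorem eq_one_of_pow_eq_one {g : Euc ι} (hg : g ∈ translations ι) {n : ℕ} (hn : 0 < n)
    (h : g ^ n = 1) : g = 1 := by
  refine Euc.ext hg ?_
  have h1 := trans_pow_of_mem_translations hg n
  rw [h] at h1
  exact (smul_eq_zero.1 h1.symm).resolve_left hn.ne'

instance : (translations ι).Normal where
  conj_mem g hg h := by
    change h.rot * g.rot * h.rot⁻¹ = 1
    rw [show g.rot = 1 from hg, mul_one, mul_inv_cancel]

/-- The vectors of the translations in `S`. -/
def translationLattice (S : Subgroup (Euc ι)) : AddSubgroup (ι → ℝ) where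
  carrier := {v | (⟨1, v⟩ : Euc ι) ∈ S}
  zero_mem' := by
    change (1 : Euc ι) ∈ S
    exact S.one_mem
  add_mem' {v w} hv hw := by
    have := S.mul_mem hv hw
    rwa [mul_def, one_mul, Matrix.UnitaryGroup.one_val, Matrix.one_mulVec] at this
  neg_mem' {v} hv := by
    have := S.inv_mem hv
    rwa [inv_def, inv_one, Matrix.UnitaryGroup.one_val, Matrix.one_mulVec] at this

/-- A space group moves every point into a bounded set by `N`-th powers of translations. -/
theorem _root_.DiscreteIsometry.IsSpaceGroup.exists_bound {S : Subgroup (Euc ι)}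
    (hS : IsSpaceGroup S) {N : ℕ} (hN : 0 < N) :
    ∃ R : ℝ, ∀ x : ι → ℝ, ∃ t ∈ S ⊓ translations ι, ∀ i, |((t ^ N).trans + x) i| ≤ R := by
  classical
  obtain ⟨-, t, ht, hli⟩ := hS
  let b := basisOfPiSpaceOfLinearIndependent hli
  have hb : ∀ i, b i = (t i).trans := fun i => by
    simp only [b, coe_basisOfPiSpaceOfLinearIndependent]
  have hN' : (0 : ℝ) < N := Nat.cast_pos.2 hN
  refine ⟨∑ i, ∑ j, N * |(t i).trans j|, fun x => ?_⟩
  -- Round down the coordinates of `x` divided by `N`: after adding `N` times this lattice vector,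
  -- each coordinate is `N` times a fractional part.
  have hmem : ∑ i, (-⌊b.repr x i / N⌋) • (t i).trans ∈ translationLattice S := by
    refine AddSubgroup.sum_mem _ fun i _ => AddSubgroup.zsmul_mem _ ?_ _
    have h1 : t i = ⟨1, (t i).trans⟩ := Euc.ext (ht i).2 rfl
    exact (h1 ▸ (ht i).1 : (⟨1, (t i).trans⟩ : Euc ι) ∈ S)
  refine ⟨⟨1, _⟩, ⟨hmem, rfl⟩, fun j => ?_⟩
  rw [trans_pow_of_mem_translations (g := ⟨1, _⟩) rfl]
  have hx : (N • ∑ i, (-⌊b.repr x i / N⌋) • (t i).trans + x) j =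
      ∑ i, (b.repr x i - N * ⌊b.repr x i / N⌋) * (t i).trans j := by
    have hxj : x j = ∑ i, b.repr x i * (t i).trans j := by
      conv_lhs => rw [← b.sum_repr x]
      simp only [hb, Finset.sum_apply, Pi.smul_apply, smul_eq_mul]
    rw [Pi.add_apply, hxj, Pi.smul_apply, Finset.sum_apply, nsmul_eq_mul, Finset.mul_sum,
      ← Finset.sum_add_distrib]
    refine Finset.sum_congr rfl fun i _ => ?_
    rw [Pi.smul_apply, zsmul_eq_mul]
    push_cast
    ring
  rw [hx]
  refine (Finset.abs_sum_le_sum_abs _ _).trans (Finset.sum_le_sum fun i _ => ?_)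
  refine le_trans ?_ (Finset.single_le_sum (f := fun j => (N : ℝ) * |(t i).trans j|)
    (fun j _ => by positivity) (Finset.mem_univ j))
  rw [abs_mul]
  refine mul_le_mul_of_nonneg_right ?_ (abs_nonneg _)
  have h1 : b.repr x i - N * ⌊b.repr x i / N⌋ = N * Int.fract (b.repr x i / N) := by
    rw [Int.fract, mul_sub, mul_div_cancel₀ _ hN'.ne']
  rw [h1, abs_of_nonneg (mul_nonneg hN'.le (Int.fract_nonneg _))]
  exact mul_le_of_le_one_right hN'.le (Int.fract_lt_one _).le

end Euc

namespace Setting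

variable {d₁ d₂ : ℕ} (S : Setting d₁ d₂)

instance : DiscreteTopology S.G := S.discrete

theorem exists_eq_directSum (g : S.G) :
    ∃ A, (g : Euc (Fin d₁ ⊕ Fin d₂)) = directSum (Fin d₁) (Fin d₂) (A, S.π g) := by
  obtain ⟨p, hp⟩ := S.le_range g.2
  have h1 : S.π g = p.2 := by
    have h2 : Subgroup.inclusion S.le_range g =
        MonoidHom.ofInjective (directSum_injective (ι := Fin d₁) (κ := Fin d₂)) p :=
      Subtype.ext hp.symm
    change ((MonoidHom.ofInjective directSum_injective).symm
      (Subgroup.inclusion S.le_range g)).2 = p.2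
    rw [h2, MulEquiv.symm_apply_apply]
  exact ⟨p.1, by rw [h1]; exact hp.symm⟩

theorem trans_inl (g : S.G) (i : Fin d₁) : (g : Euc (Fin d₁ ⊕ Fin d₂)).trans (Sum.inl i) = 0 := by
  obtain ⟨A, hA⟩ := S.exists_eq_directSum g
  rw [hA]
  rfl

theorem trans_inr (g : S.G) (i : Fin d₂) :
    (g : Euc (Fin d₁ ⊕ Fin d₂)).trans (Sum.inr i) = (S.π g).trans i := by
  obtain ⟨A, hA⟩ := S.exists_eq_directSum g
  rw [hA]
  rfl

/-- The translation part of `g` is that of `π g` padded with zeros, hence the bound `max R 0`. The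
orthogonal factor in dimension `d₁` is compact and adds no infinitude. -/
theorem finite_setOf_abs_trans_π_le (R : ℝ) : {g : S.G | ∀ i, |(S.π g).trans i| ≤ R}.Finite := by
  refine (Euc.finite_setOf_abs_trans_le S.G (max R 0)).subset fun g hg => ?_
  rintro (i | i)
  · rw [S.trans_inl, abs_zero]
    exact le_max_right _ _
  · rw [S.trans_inr]
    exact (hg i).trans (le_max_left _ _)

instance : Finite S.π.ker :=
  Set.finite_coe_iff.2 ((S.finite_setOf_abs_trans_π_le 0).subset fun g hg i => by
    rw [MonoidHom.mem_ker.1 hg]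
    exact (abs_zero (α := ℝ)).le)

theorem π_mem (g : S.G) : S.π g ∈ S.SG := by
  rw [← S.map_natProj]
  exact ⟨Subgroup.inclusion S.le_range g, g.2, rfl⟩

theorem conj_mem_TSG (g : S.G) (a : Euc (Fin d₂)) (ha : a ∈ S.TSG) :
    S.π g * a * (S.π g)⁻¹ ∈ S.TSG :=
  ⟨S.SG.mul_mem (S.SG.mul_mem (S.π_mem g) ha.1) (S.SG.inv_mem (S.π_mem g)),
    (inferInstance : (Euc.translations (Fin d₂)).Normal).conj_mem a ha.2 _⟩

variable {S} {T : Set S.G}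

theorem IsSection.goodExponents_nonempty (hT : S.IsSection T) : (goodExponents T).Nonempty :=
  DiscreteIsometry.goodExponents_nonempty hT
    (fun _ ha _ hb => Euc.mul_comm_of_mem_translations ha.2 hb.2) S.conj_mem_TSG

theorem IsSection.mul_mem_goodExponents (hT : S.IsSection T) {M N : ℕ}
    (hM : M ∈ goodExponents T) (hN : 0 < N) :
    M * N ∈ goodExponents T :=
  DiscreteIsometry.mul_mem_goodExponents hT
    (fun _ ha _ hn h => Euc.eq_one_of_pow_eq_one ha.2 hn h)
    (fun _ ha _ hb => Euc.mul_comm_of_mem_translations ha.2 hb.2) hM hN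

/-- Every coset of `H` meets the finite set of elements whose translation part is bounded by `R`. -/
theorem IsSection.finiteIndex (hT : S.IsSection T) {N : ℕ} (hN : 0 < N) {H : Subgroup S.G} (hHn : H.Normal)
    (hH : (H : Set S.G) = powSet T N) : H.FiniteIndex := by
  obtain ⟨R, hR⟩ := S.isSpaceGroup.exists_bound hN
  have hfin := S.finite_setOf_abs_trans_π_le R
  have : Finite (S.G ⧸ H) := by
    have := hfin.to_subtype
    refine Finite.of_surjective
      (fun g : {g : S.G | ∀ i, |(S.π g).trans i| ≤ R} => ((g : S.G) : S.G ⧸ H)) fun q => ?_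
    obtain ⟨g, rfl⟩ := QuotientGroup.mk_surjective q
    obtain ⟨t, ht, hb⟩ := hR (S.π g).trans
    obtain ⟨τ, hτ, rfl⟩ := hT.surjOn ht
    have hτH : τ ^ N ∈ H := by
      have : τ ^ N ∈ powSet T N := ⟨τ, hτ, rfl⟩
      rwa [← hH] at this
    refine ⟨⟨τ ^ N * g, fun i => ?_⟩, ?_⟩
    · rw [map_mul, map_pow, Euc.trans_mul_of_rot_eq_one
        ((Euc.translations (Fin d₂)).pow_mem ht.2 N)]
      exact hb i
    · have h1 : ((τ ^ N : S.G) : S.G ⧸ H) = 1 := (QuotientGroup.eq_one_iff _).2 hτH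
      simp only [QuotientGroup.mk_mul, h1, one_mul]
  exact Subgroup.finiteIndex_of_finite_quotient

end Setting

end Geometry

/-! ### Passage between levels and the periodic Fourier transform. -/

section PeriodicFourier

theorem isPeriodicWith_iff {Γ : Type} [Group Γ] {X : Type*} {T : Set Γ} {N : ℕ} {H : Subgroup Γ}
    (hH : (H : Set Γ) = powSet T N) {u : Γ → X} : IsPeriodicWith T N u ↔ RightInvariant H u := by
  rw [IsPeriodicWith, ← hH]
  exact ⟨fun h g x hx => (h g x hx).symm, fun h g x hx => (h g x hx).symm⟩

theorem IsPeriodicDualRepSet.isInequivalentSystem {Γ : Type} [Group Γ] {T : Set Γ}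
    {E : Set (URep Γ)} (hE : IsPeriodicDualRepSet T E) : IsInequivalentSystem E :=
  ⟨fun ρ hρ => (hE.1 ρ hρ).1, fun _ hρ σ hσ h =>
    (hE.2 σ (hE.1 σ hσ).1 (hE.1 σ hσ).2).unique ⟨hρ, h⟩ ⟨hσ, URep.Equivalent.refl σ⟩⟩

theorem IsPeriodicDualRepSet.exhaustsTrivialOn {Γ : Type} [Group Γ] {T : Set Γ}
    {E : Set (URep Γ)} (hE : IsPeriodicDualRepSet T E) {N : ℕ} (hN : N ∈ goodExponents T)
    {H : Subgroup Γ} (hH : (H : Set Γ) = powSet T N) : ExhaustsTrivialOn E H :=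
  fun σ hσ hσH => (hE.2 σ hσ ⟨N, hN, (isPeriodicWith_iff hH).2 hσH⟩).exists

variable {d₁ d₂ : ℕ} {S : Setting d₁ d₂} {T : Set S.G}

theorem Setting.IsSection.exists_subgroup (hT : S.IsSection T) {N : ℕ}
    (hN : N ∈ goodExponents T) :
    ∃ H : Subgroup S.G, H.Normal ∧ H.FiniteIndex ∧ (H : Set S.G) = powSet T N := by
  obtain ⟨hN0, H, hn, hH⟩ := hN
  exact ⟨H, hn, hT.finiteIndex hN0 hn hH, hH⟩

/-- Any two admissible exponents have an admissible common multiple. -/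
theorem Setting.IsSection.exists_le (hT : S.IsSection T) {M N : ℕ} (hM : M ∈ goodExponents T)
    (hN : N ∈ goodExponents T) :
    ∃ L ∈ goodExponents T, powSet T L ⊆ powSet T M ∧ powSet T L ⊆ powSet T N := by
  refine ⟨M * N, hT.mul_mem_goodExponents hM hN.1, ?_, ?_⟩
  · obtain ⟨-, H, -, hH⟩ := hM
    exact powSet_mul_subset_left hH N
  · obtain ⟨-, H, -, hH⟩ := hN
    rw [mul_comm]
    exact powSet_mul_subset_left hH M

theorem IsPeriodicWith.mono {Γ : Type} [Group Γ] {X : Type*} {T : Set Γ} {M N : ℕ} {u : Γ → X}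
    (hu : IsPeriodicWith T N u) (h : powSet T M ⊆ powSet T N) : IsPeriodicWith T M u :=
  fun g t ht => hu g t (h ht)

theorem IsPeriodicWith.comp₂ {Γ : Type} [Group Γ] {X Y Z : Type*} {T : Set Γ} {N : ℕ} {u : Γ → X}
    {v : Γ → Y} (hu : IsPeriodicWith T N u) (hv : IsPeriodicWith T N v) (φ : X → Y → Z) :
    IsPeriodicWith T N (fun g => φ (u g) (v g)) :=
  fun g t ht => by simp only [← hu g t ht, ← hv g t ht]

theorem Setting.IsSection.exists_common (hT : S.IsSection T) {X Y : Type*} {u : S.G → X}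
    {v : S.G → Y} (hu : IsPeriodic T u) (hv : IsPeriodic T v) :
    ∃ N ∈ goodExponents T, IsPeriodicWith T N u ∧ IsPeriodicWith T N v := by
  obtain ⟨M, hM, hu⟩ := hu
  obtain ⟨N, hN, hv⟩ := hv
  obtain ⟨L, hL, h1, h2⟩ := hT.exists_le hM hN
  exact ⟨L, hL, hu.mono h1, hv.mono h2⟩

theorem Setting.IsSection.exists_common_finset (hT : S.IsSection T) {ι : Type*} {X : ι → Type*}
    {u : ∀ i, S.G → X i} (s : Finset ι) (hu : ∀ i ∈ s, IsPeriodic T (u i)) :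
    ∃ N ∈ goodExponents T, ∀ i ∈ s, IsPeriodicWith T N (u i) := by
  classical
  induction s using Finset.induction_on with
  | empty =>
    obtain ⟨N, hN⟩ := hT.goodExponents_nonempty
    exact ⟨N, hN, by simp⟩
  | insert i s _ ih =>
    obtain ⟨M, hM, hMs⟩ := ih fun j hj => hu j (Finset.mem_insert_of_mem hj)
    obtain ⟨N, hN, hNi⟩ := hu i (Finset.mem_insert_self i s)
    obtain ⟨L, hL, h1, h2⟩ := hT.exists_le hM hN
    refine ⟨L, hL, fun j hj => ?_⟩
    rcases Finset.mem_insert.1 hj with rfl | hj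
    · exact hNi.mono h2
    · exact (hMs j hj).mono h1

/-- The average of a periodic function depends neither on the exponent nor on the representation
set. -/
theorem Setting.IsSection.average_eq (hT : S.IsSection T) {V : Type*} [AddCommGroup V]
    [Module ℂ V] {f : S.G → V} {M N : ℕ} (hM : M ∈ goodExponents T) (hN : N ∈ goodExponents T)
    (hfM : IsPeriodicWith T M f) (hfN : IsPeriodicWith T N f) {C D : Set S.G}
    (hC : IsCosetRepSet T M C) (hD : IsCosetRepSet T N D) : average C f = average D f := by
  obtain ⟨L, hL, h1, h2⟩ := hT.exists_le hM hN
  obtain ⟨H, -, -, hH⟩ := hT.exists_subgroup hM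
  obtain ⟨H', -, -, hH'⟩ := hT.exists_subgroup hN
  obtain ⟨K, -, _, hK⟩ := hT.exists_subgroup hL
  rw [isPeriodicWith_iff hH] at hfM
  rw [isPeriodicWith_iff hH'] at hfN
  rw [average_eq_cosetMean hH hC hfM, average_eq_cosetMean hH' hD hfN,
    ← cosetMean_of_le (K := K) (by rwa [← SetLike.coe_subset_coe, hK, hH]) hfM,
    ← cosetMean_of_le (K := K) (by rwa [← SetLike.coe_subset_coe, hK, hH']) hfN]

variable {C : ℕ → Set S.G} {m n : ℕ}

theorem Setting.IsSection.perFourier_eq_average (hT : S.IsSection T)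
    (hC : ∀ N ∈ goodExponents T, IsCosetRepSet T N (C N)) {u : S.G → Matrix (Fin m) (Fin n) ℂ}
    {ρ : URep S.G} {N : ℕ} (hN : N ∈ goodExponents T) (hu : IsPeriodicWith T N u)
    (hρ : IsPeriodicWith T N ρ.mat) {D : Set S.G} (hD : IsCosetRepSet T N D) :
    perFourier T C u ρ = average D (fun g => u g ⊗ₖ ρ.mat g) := by
  have h : ∃ N ∈ goodExponents T, IsPeriodicWith T N u ∧ IsPeriodicWith T N ρ.mat :=
    ⟨N, hN, hu, hρ⟩
  rw [perFourier, dif_pos h]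
  obtain ⟨h1, h2, h3⟩ := h.choose_spec
  exact hT.average_eq h1 hN (h2.comp₂ h3 fun A B => A ⊗ₖ B) (hu.comp₂ hρ fun A B => A ⊗ₖ B)
    (hC _ h1) hD

theorem Setting.IsSection.perInner_eq_average (hT : S.IsSection T)
    (hC : ∀ N ∈ goodExponents T, IsCosetRepSet T N (C N))
    {u v : S.G → Matrix (Fin m) (Fin n) ℂ} {N : ℕ} (hN : N ∈ goodExponents T)
    (hu : IsPeriodicWith T N u) (hv : IsPeriodicWith T N v) {D : Set S.G}
    (hD : IsCosetRepSet T N D) :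
    perInner T C u v = average D (fun g => frobenius (u g) (v g)) := by
  have h : ∃ N ∈ goodExponents T, IsPeriodicWith T N u ∧ IsPeriodicWith T N v :=
    ⟨N, hN, hu, hv⟩
  rw [perInner, dif_pos h]
  obtain ⟨h1, h2, h3⟩ := h.choose_spec
  exact hT.average_eq h1 hN (h2.comp₂ h3 frobenius) (hu.comp₂ hv frobenius) (hC _ h1) hD

theorem Setting.IsSection.perFourier_eq_cosetMean (hT : S.IsSection T)
    (hC : ∀ N ∈ goodExponents T, IsCosetRepSet T N (C N)) {u : S.G → Matrix (Fin m) (Fin n) ℂ}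
    {ρ : URep S.G} {N : ℕ} (hN : N ∈ goodExponents T) {H : Subgroup S.G}
    (hH : (H : Set S.G) = powSet T N) (hu : RightInvariant H u) (hρ : RightInvariant H ρ.mat) :
    perFourier T C u ρ = cosetMean H (fun g => u g ⊗ₖ ρ.mat g) := by
  rw [hT.perFourier_eq_average hC hN ((isPeriodicWith_iff hH).2 hu) ((isPeriodicWith_iff hH).2 hρ)
    (hC N hN), average_eq_cosetMean hH (hC N hN) (hu.comp₂ hρ fun A B => A ⊗ₖ B)]

/-- The Fourier transform of a `T ^ N`-periodic function vanishes at the irreducible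
representations that are not `T ^ N`-periodic. -/
theorem Setting.IsSection.perFourier_eq_zero (hT : S.IsSection T)
    (hC : ∀ N ∈ goodExponents T, IsCosetRepSet T N (C N)) {u : S.G → Matrix (Fin m) (Fin n) ℂ}
    {ρ : URep S.G} {N : ℕ} (hN : N ∈ goodExponents T) {H : Subgroup S.G} [H.Normal]
    (hH : (H : Set S.G) = powSet T N) (hu : RightInvariant H u) (hρ : ρ.IsIrreducible)
    (hρper : IsPeriodic T ρ.mat) (hne : ¬ RightInvariant H ρ.mat) : perFourier T C u ρ = 0 := by
  obtain ⟨M, hM, hρM⟩ := hρper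
  obtain ⟨L, hL, h1, h2⟩ := hT.exists_le hN hM
  obtain ⟨K, -, _, hK⟩ := hT.exists_subgroup hL
  have hKH : K ≤ H := by rwa [← SetLike.coe_subset_coe, hK, hH]
  have hρK : RightInvariant K ρ.mat := (isPeriodicWith_iff hK).1 (hρM.mono h2)
  rw [hT.perFourier_eq_cosetMean hC hL hK (hu.mono hKH) hρK]
  ext ⟨a, i⟩ ⟨b, j⟩
  rw [cosetMean_kronecker_apply]
  exact cosetMean_mul_mat_eq_zero hKH (rightInvariant_entry hu a b) hρ hρK hne i j

variable {E : Set (URep S.G)}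

theorem Setting.IsSection.perFourier_injOn (hT : S.IsSection T)
    (hC : ∀ N ∈ goodExponents T, IsCosetRepSet T N (C N)) (hE : IsPeriodicDualRepSet T E)
    {u v : S.G → Matrix (Fin m) (Fin n) ℂ} (hu : u ∈ LPer T m n) (hv : v ∈ LPer T m n)
    (h : ∀ ρ ∈ E, perFourier T C u ρ = perFourier T C v ρ) : u = v := by
  obtain ⟨N, hN, hu, hv⟩ := hT.exists_common hu hv
  obtain ⟨H, _, _, hH⟩ := hT.exists_subgroup hN
  rw [isPeriodicWith_iff hH] at hu hv
  funext g
  ext a b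
  have hu' := synthesis_cosetMean hE.isInequivalentSystem (hE.exhaustsTrivialOn hN hH)
    (rightInvariant_entry hu a b)
  have hv' := synthesis_cosetMean hE.isInequivalentSystem (hE.exhaustsTrivialOn hN hH)
    (rightInvariant_entry hv a b)
  refine (congrFun hu' g).symm.trans (Eq.trans ?_ (congrFun hv' g))
  refine Finset.sum_congr rfl fun ρ hρ => Finset.sum_congr rfl fun i _ =>
    Finset.sum_congr rfl fun j _ => ?_
  obtain ⟨hρE, hρH⟩ := (Set.Finite.mem_toFinset _).1 hρ
  have h1 := congrFun (congrFun (h ρ hρE) (a, i)) (b, j)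
  rw [hT.perFourier_eq_cosetMean hC hN hH hu hρH, hT.perFourier_eq_cosetMean hC hN hH hv hρH,
    cosetMean_kronecker_apply, cosetMean_kronecker_apply] at h1
  exact congrArg (fun z => ρ.dim * z * conj (ρ.mat g i j)) h1

/-- Finitely many periodic representations share a level, and at that level the function is
synthesized entry by entry. -/
theorem Setting.IsSection.exists_perFourier_eq (hT : S.IsSection T)
    (hC : ∀ N ∈ goodExponents T, IsCosetRepSet T N (C N)) (hE : IsPeriodicDualRepSet T E)
    (x : ∀ ρ : E, Matrix (Fin m × Fin (ρ : URep S.G).dim) (Fin n × Fin (ρ : URep S.G).dim) ℂ)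
    (hx : {ρ | x ρ ≠ 0}.Finite) :
    ∃ u ∈ LPer T m n, ∀ ρ : E, perFourier T C u ρ = x ρ := by
  classical
  obtain ⟨N, hN, hper⟩ := hT.exists_common_finset (u := fun ρ : E => (ρ : URep S.G).mat)
    hx.toFinset fun ρ _ => (hE.1 ρ ρ.2).2
  obtain ⟨H, _, _, hH⟩ := hT.exists_subgroup hN
  have hsys := hE.isInequivalentSystem
  have hs : ∀ ρ ∈ (finite_trivialOn hsys H).toFinset, ρ ∈ trivialOn E H := fun ρ hρ =>
    (Set.Finite.mem_toFinset _).1 hρ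
  -- The value `0` outside `E` is never used: the synthesis runs over `trivialOn E H`, a subset of
  -- `E`.
  let B : Fin m → Fin n → ∀ ρ : URep S.G, Matrix (Fin ρ.dim) (Fin ρ.dim) ℂ := fun a b ρ =>
    if h : ρ ∈ E then Matrix.of fun i j => x ⟨ρ, h⟩ (a, i) (b, j) else 0
  let u : S.G → Matrix (Fin m) (Fin n) ℂ := fun g =>
    Matrix.of fun a b => synthesis (finite_trivialOn hsys H).toFinset (B a b) g
  have hu : RightInvariant H u := fun g h hh => by
    ext a b
    exact rightInvariant_synthesis (fun ρ hρ => (hs ρ hρ).2) (B a b) g h hh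
  refine ⟨u, ⟨N, hN, (isPeriodicWith_iff hH).2 hu⟩, fun ρ => ?_⟩
  by_cases hρ : RightInvariant H (ρ : URep S.G).mat
  · rw [hT.perFourier_eq_cosetMean hC hN hH hu hρ]
    ext ⟨a, i⟩ ⟨b, j⟩
    rw [cosetMean_kronecker_apply]
    have hmem : (ρ : URep S.G) ∈ trivialOn E H := ⟨ρ.2, hρ⟩
    refine (cosetMean_synthesis hsys hs (B a b) hmem i j).trans ?_
    rw [if_pos ((Set.Finite.mem_toFinset _).2 hmem)]
    simp only [B, dif_pos ρ.2, Matrix.of_apply]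
  -- Off the level both sides vanish: the level was chosen so that every `ρ` with `x ρ ≠ 0` is
  -- trivial on `H`.
  · rw [hT.perFourier_eq_zero hC hN hH hu (hE.1 ρ ρ.2).1 (hE.1 ρ ρ.2).2 hρ]
    by_contra h0
    exact hρ ((isPeriodicWith_iff hH).1 (hper ρ ((Set.Finite.mem_toFinset _).2 (Ne.symm h0))))

theorem Setting.IsSection.finite_perFourier_ne_zero (hT : S.IsSection T)
    (hC : ∀ N ∈ goodExponents T, IsCosetRepSet T N (C N)) (hE : IsPeriodicDualRepSet T E)
    {u : S.G → Matrix (Fin m) (Fin n) ℂ} (hu : u ∈ LPer T m n) :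
    {ρ : E | perFourier T C u ρ ≠ 0}.Finite := by
  obtain ⟨N, hN, hu⟩ := hu
  obtain ⟨H, _, _, hH⟩ := hT.exists_subgroup hN
  rw [isPeriodicWith_iff hH] at hu
  refine Set.Finite.of_finite_image (f := Subtype.val)
    ((finite_trivialOn hE.isInequivalentSystem H).subset ?_) Subtype.val_injective.injOn
  rintro _ ⟨ρ, hρ, rfl⟩
  refine ⟨ρ.2, ?_⟩
  by_contra hne
  exact hρ (hT.perFourier_eq_zero hC hN hH hu (hE.1 ρ ρ.2).1 (hE.1 ρ ρ.2).2 hne)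

/-- Plancherel's formula. -/
theorem Setting.IsSection.perInner_eq_finsum (hT : S.IsSection T)
    (hC : ∀ N ∈ goodExponents T, IsCosetRepSet T N (C N)) (hE : IsPeriodicDualRepSet T E)
    {u v : S.G → Matrix (Fin m) (Fin n) ℂ} (hu : u ∈ LPer T m n) (hv : v ∈ LPer T m n) :
    perInner T C u v =
      ∑ᶠ ρ : E, ((ρ : URep S.G).dim : ℂ) *
        frobenius (perFourier T C u ρ) (perFourier T C v ρ) := by
  obtain ⟨N, hN, hu, hv⟩ := hT.exists_common hu hv
  obtain ⟨H, _, _, hH⟩ := hT.exists_subgroup hN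
  rw [hT.perInner_eq_average hC hN hu hv (hC N hN)]
  rw [isPeriodicWith_iff hH] at hu hv
  rw [average_eq_cosetMean hH (hC N hN) (hu.comp₂ hv frobenius),
    cosetMean_frobenius hE.isInequivalentSystem (hE.exhaustsTrivialOn hN hH) hu,
    finsum_set_coe_eq_finsum_mem (f := fun ρ : URep S.G => (ρ.dim : ℂ) *
      frobenius (perFourier T C u ρ) (perFourier T C v ρ)) E,
    finsum_mem_eq_sum_of_inter_support_eq (s := E)
      (t := (finite_trivialOn hE.isInequivalentSystem H).toFinset)]
  · refine Finset.sum_congr rfl fun ρ hρ => ?_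
    have hρH := ((Set.Finite.mem_toFinset _).1 hρ).2
    rw [hT.perFourier_eq_cosetMean hC hN hH hu hρH, hT.perFourier_eq_cosetMean hC hN hH hv hρH]
  -- The sum over `E` reduces to `trivialOn E H`, since the transform of `u` vanishes at the other
  -- members of `E`.
  · rw [Set.Finite.coe_toFinset]
    ext ρ
    refine ⟨fun h => ⟨⟨h.1, ?_⟩, h.2⟩, fun h => ⟨h.1.1, h.2⟩⟩
    by_contra hne
    refine h.2 ?_
    change (ρ.dim : ℂ) * frobenius _ _ = 0
    rw [hT.perFourier_eq_zero hC hN hH hu (hE.1 ρ h.1).1 (hE.1 ρ h.1).2 hne]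
    simp [frobenius]

end PeriodicFourier

end DiscreteIsometry

end

theorem mainTheorem5 {d₁ d₂ : ℕ} (S : Setting d₁ d₂) (T : Set S.G) (hT : S.IsSection T)
    (C : ℕ → Set S.G) (hC : ∀ N ∈ goodExponents T, IsCosetRepSet T N (C N))
    (E : Set (URep S.G)) (hE : IsPeriodicDualRepSet T E) (m n : ℕ) :
    -- the averages defining the Fourier transform and the inner product make sense
    (∀ N ∈ goodExponents T, ∀ D : Set S.G, IsCosetRepSet T N D → D.Finite ∧ D.Nonempty) ∧
    (∀ u ∈ LPer T m n, ∀ ρ : URep S.G, IsPeriodic T ρ.mat →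
      (∃ N ∈ goodExponents T, IsPeriodicWith T N u ∧ IsPeriodicWith T N ρ.mat) ∧
      ∀ N ∈ goodExponents T, IsPeriodicWith T N u → IsPeriodicWith T N ρ.mat →
        ∀ D : Set S.G, IsCosetRepSet T N D →
          perFourier T C u ρ = average D (fun g => u g ⊗ₖ ρ.mat g)) ∧
    (∀ u ∈ LPer T m n, ∀ v ∈ LPer T m n,
      (∃ N ∈ goodExponents T, IsPeriodicWith T N u ∧ IsPeriodicWith T N v) ∧
      ∀ N ∈ goodExponents T, IsPeriodicWith T N u → IsPeriodicWith T N v →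
        ∀ D : Set S.G, IsCosetRepSet T N D →
          perInner T C u v = average D (fun g => frobenius (u g) (v g))) ∧
    -- the Fourier transform maps into the direct sum and is bijective
    (∃ Φ : LPer T m n →
        ⨁ ρ : E, Matrix (Fin m × Fin (ρ : URep S.G).dim) (Fin n × Fin (ρ : URep S.G).dim) ℂ,
      (∀ (u : LPer T m n) (ρ : E), Φ u ρ = perFourier T C (u : S.G → Matrix (Fin m) (Fin n) ℂ) ρ) ∧
      Function.Bijective Φ) ∧
    -- the Plancherel formula
    (∀ u ∈ LPer T m n, ∀ v ∈ LPer T m n,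
      perInner T C u v =
        ∑ᶠ ρ : E, ((ρ : URep S.G).dim : ℂ) * frobenius (perFourier T C u ρ) (perFourier T C v ρ)) := by

  classical
  refine ⟨fun N hN D hD => ?_, fun u hu ρ hρ => ⟨hT.exists_common hu hρ, fun N hN huN hρN D hD =>
    hT.perFourier_eq_average hC hN huN hρN hD⟩, fun u hu v hv => ⟨hT.exists_common hu hv,
    fun N hN huN hvN D hD => hT.perInner_eq_average hC hN huN hvN hD⟩, ?_,
    fun u hu v hv => hT.perInner_eq_finsum hC hE hu hv⟩
  · obtain ⟨H, -, _, hH⟩ := hT.exists_subgroup hN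
    exact ⟨finite_of_isCosetRepSet hH hD, nonempty_of_isCosetRepSet hD⟩
  · refine ⟨fun u => DFinsupp.mk (hT.finite_perFourier_ne_zero hC hE u.2).toFinset
      fun ρ => perFourier T C u ρ, ?_⟩
    -- `DFinsupp.mk` extends by zero outside the given finite set, which is exactly the set where
    -- the transform is nonzero.
    have hΦ : ∀ (u : LPer T m n) (ρ : E),
        (DFinsupp.mk (β := fun ρ : E => Matrix (Fin m × Fin (ρ : URep S.G).dim)
          (Fin n × Fin (ρ : URep S.G).dim) ℂ)
          (hT.finite_perFourier_ne_zero hC hE u.2).toFinset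
          fun ρ => perFourier T C (u : S.G → Matrix (Fin m) (Fin n) ℂ) ρ) ρ =
          perFourier T C (u : S.G → Matrix (Fin m) (Fin n) ℂ) ρ := fun u ρ => by
      rw [DFinsupp.mk_apply]
      split_ifs with h
      · rfl
      · by_contra hne
        exact h ((Set.Finite.mem_toFinset _).2 (Ne.symm hne))
    refine ⟨hΦ, fun u v huv => Subtype.ext (hT.perFourier_injOn hC hE u.2 v.2 fun ρ hρ => ?_),
      fun x => ?_⟩
    · have h1 := hΦ u ⟨ρ, hρ⟩
      have h2 := hΦ v ⟨ρ, hρ⟩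
      exact h1.symm.trans ((DFunLike.congr_fun huv (⟨ρ, hρ⟩ : E)).trans h2)
    · obtain ⟨u, hu, hux⟩ := hT.exists_perFourier_eq hC hE (fun ρ => x ρ)
        (by
          refine (DFinsupp.support x).finite_toSet.subset fun ρ hρ => ?_
          exact DFinsupp.mem_support_iff.2 hρ)
      exact ⟨⟨u, hu⟩, DFinsupp.ext fun ρ => (hΦ ⟨u, hu⟩ ρ).trans (hux ρ)⟩
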